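/- Let $\Phi$ be a finite crystallographic (reduced, not necessarily irreducible) root system spanning a real vector space, with simple roots $\alpha_s$ ($s\in S$), Weyl group $W$ generated by the simple reflections $S$, and longest element $w_\circ$. Let $n=|S|$, let $N$ be the length of $w_\circ$ and put $m=n+N$. A Coxeter element is a product of all elements of $S$, each once, in some order. For a reduced expression $c=(c_1,\dots,c_n)$ of a Coxeter element let $w_\circ(c)$ be the lexicographically first subword of $c\,c\,c\cdots$ which is a reduced expression of $w_\circ$, and let $Q_c=c\,w_\circ(c)=(q_1,\dots,q_m)$. A $c$-cluster is a set $I\subseteq[m]$ of positions such that the subword of $Q_c$ at the positions in $[m]\setminus I$ is a reduced expression of $w_\circ$. Its root function is $r(I,j)=\sigma_{[j-1]\setminus I}(\alpha_{q_j})$, where $\sigma_X$ is the product of the reflections $q_x$, $x\in X$, in increasing order of $x$. For $i,j\in[m]$ choose a $c$-cluster $I$ containing $i$, write $r(I,j)=\sum_{k\in I}\rho_k\, r(I,k)$ and set $$\{i\parallel_c j\}=\begin{cases}\rho_i & \text{if } j>i,\\ -\rho_i & \text{if } j\le i.\end{cases}$$ Let $\tilde Q$ be the bi-infinite word $\cdots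 w\,w\,w\cdots$, where $w$ lists the elements of $S$, each once, in any fixed order. For $s\in S$ put $\eta(s)=w_\circ s w_\circ$. For every $c$, fix an identification of the positions of the bi-infinite word $\cdots Q_c\,\eta(Q_c)\,Q_c\,\eta(Q_c)\cdots$ with those of $\tilde Q$ up to commutations, that is, a bijection of positions which keeps the letters and keeps the relative order of any two occurrences of equal or of non-commuting letters. For a position $i$ of $Q_c$, let $\tilde i$ be its orbit in $\tilde Q$ under the translation by $m$ letters of $\cdots Q_c\,\eta(Q_c)\,Q_c\,\eta(Q_c)\cdots$. **Proposition 4.2.** The coefficients $\{i\parallel_c j\}$ exist and do not depend on the cluster $I\ni i$ or on the decomposition used. Let $c$ and $c'$ be reduced expressions of two Coxeter elements, let $i,j$ be positions in $Q_c$ and $i',j'$ positions in $Q_{c'}$ such that $\tilde i=\tilde i'$ and $\tilde j=\tilde j'$ in $\tilde Q$, for any choice of the identifications. Then $\{i\parallel_c j\}=\{i'\parallel_{c'}j'\}$. Consequently there is a function $F$ of pairs of orbits, depending neither on $c$ nor on the identification, such that $\{i\parallel_c j\}=F(\tilde i,\tilde j)$ for all $c$ and all positions $i,j$ of $Q_c$;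 that is, $\{\tilde i\parallel\tilde j\}$ is well defined. -/

import Mathlib

noncomputable section

namespace ClusterOrbit

variable {ι V V' : Type*} [AddCommGroup V] [Module ℝ V] [AddCommGroup V'] [Module ℝ V']
  {P : RootPairing ι ℝ V V'}

/-- The simple reflection attached to a simple root, as an element of the Weyl group. -/
def simpleReflection (b : P.Base) (s : b.support) : P.weylGroup :=
  RootPairing.weylGroup.ofIdx P s

/-- The element of the Weyl group represented by a word in the simple reflections. -/
def wordProd (b : P.Base) (w : List b.support) : P.weylGroup :=
  (w.map (simpleReflection b)).prod

/-- The Coxeter length: the least length of a word in the simple reflections representing `g`. -/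
def coxeterLength (b : P.Base) (g : P.weylGroup) : ℕ :=
  sInf {k | ∃ w : List b.support, w.length = k ∧ wordProd b w = g}

/-- `w` is a reduced expression of `g`. -/
def IsReducedExpression (b : P.Base) (w : List b.support) (g : P.weylGroup) : Prop :=
  wordProd b w = g ∧ w.length = coxeterLength b g

/-- `w` lists every simple reflection exactly once. -/
def IsOrdering (b : P.Base) (w : List b.support) : Prop :=
  w.Nodup ∧ ∀ s : b.support, s ∈ w

/-- A Coxeter element: the product of all simple reflections, in some order. -/
def IsCoxeterElement (b : P.Base) (g : P.weylGroup) : Prop :=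
  ∃ w : List b.support, IsOrdering b w ∧ wordProd b w = g

/-- `c` is a reduced expression of a Coxeter element. -/
def IsCoxeterWord (b : P.Base) (c : List b.support) : Prop :=
  ∃ g : P.weylGroup, IsCoxeterElement b g ∧ IsReducedExpression b c g

/-- The Weyl group of a finite root system is finite. -/
theorem finite_weylGroup [Finite ι] [P.IsRootSystem] : Finite P.weylGroup := by
  refine Finite.of_injective (fun g : P.weylGroup => P.weylGroupToPerm g) ?_
  intro g h hgh
  have hgh' : P.weylGroupToPerm g = P.weylGroupToPerm h := hgh
  refine Subtype.ext (RootPairing.Equiv.weightHom_injective P ?_)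
  refine LinearEquiv.toLinearMap_injective ?_
  have hspan : Submodule.span ℝ (Set.range P.root) = ⊤ :=
    RootPairing.IsRootSystem.span_root_eq_top
  refine LinearMap.ext_on_range hspan fun i => ?_
  have h1 := P.weylGroup_apply_root g i
  have h2 := P.weylGroup_apply_root h i
  rw [hgh'] at h1
  exact h1.trans h2.symm

/-- The longest element of the Weyl group: an element of maximal length (there is only one). -/
def longestElement [Finite ι] [P.IsRootSystem] (b : P.Base) : P.weylGroup :=
  haveI := finite_weylGroup (P := P)
  (Finite.exists_max (coxeterLength b)).choose

/-- The subword of `Q` formed by the letters at the positions in `X`, in increasing order. -/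
def subword {B : Type*} (Q : List B) (X : Finset (Fin Q.length)) : List B :=
  (X.sort (· ≤ ·)).map Q.get

section

variable [Finite ι] [P.IsRootSystem]

/-- `p` is an increasing list of positions of the infinite word `c c c ⋯` that spells a reduced
expression of the longest element. The position `(k, a)` is the `a`-th letter of the `k`-th copy
of `c`, and positions are ordered lexicographically, i.e. from left to right. -/
def SpellsLongest (b : P.Base) (c : List b.support) (p : List (ℕ ×ₗ Fin c.length)) : Prop :=
  p.Pairwise (· < ·) ∧
    IsReducedExpression b (p.map fun x => c.get (ofLex x).2) (longestElement b)

/-- `p` is the lexicographically first list of positions of `c c c ⋯` that spells a reduced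
expression of the longest element. -/
def IsFirstSpelling (b : P.Base) (c : List b.support) (p : List (ℕ ×ₗ Fin c.length)) : Prop :=
  SpellsLongest b c p ∧ ∀ q, SpellsLongest b c q → p ≤ q

open Classical in
/-- The `c`-sorting word of the longest element: the lexicographically first subword of
`c c c ⋯` which is a reduced expression of it. There is exactly one such list of positions as soon
as every simple reflection occurs in `c`; the other branch is never used for such `c`. -/
def sortingWord (b : P.Base) (c : List b.support) : List b.support :=
  if h : ∃ p, IsFirstSpelling b c p then h.choose.map (fun x => c.get (ofLex x).2) else []

/-- The word `Q_c`, which is `c` followed by the `c`-sorting word of the longest element. -/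
def wordQ (b : P.Base) (c : List b.support) : List b.support :=
  c ++ sortingWord b c

/-- A set `I` of positions of `Q` is a cluster (a facet of the subword complex of `Q` and the
longest element) when the subword at the complement of `I` is a reduced expression of the longest
element. -/
def IsCluster (b : P.Base) (Q : List b.support) (I : Finset (Fin Q.length)) : Prop :=
  IsReducedExpression b (subword Q Iᶜ) (longestElement b)

/-- The root function `r(I, j)`: the simple root of the `j`-th letter of `Q`, moved by the product
of the letters of `Q` at the positions before `j` that are not in `I`. -/
def rootFunction (b : P.Base) (Q : List b.support) (I : Finset (Fin Q.length))
    (j : Fin Q.length) : V :=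
  wordProd b (subword Q (Finset.Iio j \ I)) • P.root (Q.get j)

/-- `d` is a value of the coefficient `{i ‖ j}` in `Q`: for some cluster `I` containing `i` and
some decomposition `r(I, j) = ∑ k ∈ I, ρ k • r(I, k)`, one has `d = ρ i` if `j > i` and
`d = -ρ i` if `j ≤ i`. -/
def IsCompatibilityDegree (b : P.Base) (Q : List b.support) (i j : Fin Q.length) (d : ℝ) : Prop :=
  ∃ I : Finset (Fin Q.length), IsCluster b Q I ∧ i ∈ I ∧
    ∃ ρ : Fin Q.length → ℝ,
      rootFunction b Q I j = ∑ k ∈ I, ρ k • rootFunction b Q I k ∧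
        d = if i < j then ρ i else -ρ i

end

/-- The bi-infinite word `⋯ w w w ⋯`, whose letters are simple reflections. The position `(k, a)`,
for `k` an integer, is the `a`-th letter of the `k`-th copy of `w`; positions are ordered
lexicographically, i.e. from left to right. -/
def tildeWord (b : P.Base) (w : List b.support) : ℤ ×ₗ Fin w.length → P.weylGroup :=
  fun x => simpleReflection b (w.get (ofLex x).2)

/-- The bi-infinite word `⋯ Q_c η(Q_c) Q_c η(Q_c) ⋯`, where `η` is the conjugation by the longest
element `w₀`, and `η ^ 2 = 1` since `w₀ = w₀⁻¹`. The position `(k, i)` is the `i`-th letter of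
`η ^ k (Q_c)`; moving `m = |Q_c|` letters to the right is `(k, i) ↦ (k + 1, i)`. -/
def tildeWordQ [Finite ι] [P.IsRootSystem] (b : P.Base) (c : List b.support) :
    ℤ ×ₗ Fin (wordQ b c).length → P.weylGroup :=
  fun x => (MulAut.conj (longestElement b) ^ (ofLex x).1)
    (simpleReflection b ((wordQ b c).get (ofLex x).2))

/-- An identification of the positions of the words `u` and `v` (indexed by linear orders, possibly
infinite) through commutations of consecutive commuting letters: a bijection between the positions
that keeps the letters, and keeps the relative order of any two occurrences of the same letter and
of any two occurrences of letters that do not commute. -/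
structure CommutationEquiv {G α β : Type*} [Group G] [LinearOrder α] [LinearOrder β]
    (u : α → G) (v : β → G) extends α ≃ β where
  letter_eq (x : α) : v (toEquiv x) = u x
  lt_of_lt (x y : α) (hxy : u x = u y ∨ ¬ Commute (u x) (u y)) (h : x < y) :
    toEquiv x < toEquiv y

/-- The orbit, in the bi-infinite word `⋯ w w w ⋯`, of the position `i` of `Q_c` under the
translation by `|Q_c|` letters, when `⋯ Q_c η(Q_c) Q_c η(Q_c) ⋯` is identified with `⋯ w w w ⋯`
through the commutations `e`. -/
def orbit [Finite ι] [P.IsRootSystem] (b : P.Base) {w c : List b.support}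
    (e : CommutationEquiv (tildeWordQ b c) (tildeWord b w)) (i : Fin (wordQ b c).length) :
    Set (ℤ ×ₗ Fin w.length) :=
  Set.range fun k : ℤ => e.toEquiv (toLex (k, i))

end ClusterOrbit

end

/-!
The idea is that `{i ‖ j}`, as a function of `j`, solves recurrence relations that can be read off
from the bi-infinite word `⋯ w w w ⋯` and that determine it.

*Independence of the cluster.* Two clusters that differ by a flip have root functions that differ
by the reflection in the root of the exchanged position. A linear form that vanishes on the roots of
the positions unused by one cluster therefore takes the same values on the root functions of all
other clusters in the same word (`IsReducedSubword.apply_rootAt_eq`). If a word is rotated so that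
`i` comes first, then `r(I, i)` is the simple root of its letter for every cluster `I` that contains
`i`, and the coordinate form of that simple root vanishes at the other positions of a suitable
cluster, the one formed by the first occurrences of the letters. Hence the coefficient of `r(I, i)`
is read off by this form whatever cluster and decomposition are used. Rotation is harmless, since
moving a letter to the end of the word, twisted by `η`, changes root functions by a reflection and
a sign (`isReducedSubword_rotate_iff`, `isCompatibilityDegree_iff`).

*Mesh relations.* With respect to the cluster of first occurrences, the root function at two
consecutive occurrences `y < z` of a letter shows that `{i ‖ y} + {i ‖ z}` is the sum of the
`max({i ‖ x}, 0)`, weighted by minus the Cartan integers, over the positions `x` in between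
(`isMeshSolution_meshFun`). Together with the value `-1` at `i` and the value `0` to the left of
`i`, this determines `{i ‖ ·}` on a window of one period, and the relations only involve the relative
order of equal and of non-commuting letters (`IsMeshSolution.eq_of_equiv`). An identification of two
words up to commutations may move a position out of the window at either end; as the relations can
also be read from right to left, both coefficients vanish in that case (`meshFun_eq_of_equiv`).

*Orbits.* The translation of `⋯ Q_c η(Q_c) Q_c η(Q_c) ⋯` by one period moves the occurrences of a
letter `s` in `⋯ w w w ⋯` to those of `η s`, by a number `τ s` of copies of `w`. For two Coxeter
words the difference of these numbers is constant on each component of the Coxeter graph, and if the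
two translations have an orbit in common, then the difference vanishes on the component of its
letter (`IsShift.eq_of_range_eq`). So equal orbits of `i` and `j` give corresponding positions in the two
words, and the uniqueness of the solutions of the mesh relations applies.
-/

set_option linter.unusedSectionVars false

noncomputable section

namespace ClusterOrbit

section

variable {ι V V' : Type*} [AddCommGroup V] [Module ℝ V] [AddCommGroup V'] [Module ℝ V']
  {P : RootPairing ι ℝ V V'}

/-! ### Roots and simple reflections -/

lemma simpleReflection_smul (b : P.Base) (s : b.support) (v : V) :
    simpleReflection b s • v = v - P.coroot' s v • P.root s := by
  change P.reflection s v = _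
  rw [RootPairing.reflection_apply]

lemma weylGroup_smul_smul (g : P.weylGroup) (r : ℝ) (v : V) : g • (r • v) = r • (g • v) := by
  exact smul_comm (g : P.Aut) r v

/-- The action of an element of the Weyl group on the root space, as a linear map. -/
def actionMap (g : P.weylGroup) : V →ₗ[ℝ] V where
  toFun v := g • v
  map_add' := smul_add g
  map_smul' r v := weylGroup_smul_smul g r v

@[simp] lemma actionMap_apply (g : P.weylGroup) (v : V) : actionMap g v = g • v := rfl

lemma weylGroup_ext {g h : P.weylGroup} (H : ∀ v : V, g • v = h • v) : g = h := by
  refine Subtype.ext (RootPairing.Equiv.weightHom_injective P ?_)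
  refine LinearEquiv.toLinearMap_injective ?_
  ext v
  exact H v

lemma coroot'_weylGroup_smul (g : P.weylGroup) (i : ι) (v : V) :
    P.coroot' (P.weylGroupToPerm g i) (g • v) = P.coroot' i v := by
  obtain ⟨g, hg⟩ := g
  induction hg using RootPairing.weylGroup.induction generalizing i v with
  | mem j =>
    change P.coroot' (P.reflectionPerm j i) (P.reflection j v) = _
    rw [RootPairing.coroot'_reflectionPerm]
    simp [RootPairing.reflection_same]
  | one => rfl
  | mul x y hx hy h1 h2 =>
    exact (h1 _ ((⟨y, hy⟩ : P.weylGroup) • v)).trans (h2 i v)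

/-- An element of the Weyl group that carries a simple root to a simple root conjugates
the corresponding simple reflections into each other. -/
lemma mul_simpleReflection_of_smul_eq (b : P.Base) {g : P.weylGroup} {s t : b.support}
    (h : g • P.root t = P.root s) :
    g * simpleReflection b t = simpleReflection b s * g := by
  have hp : P.weylGroupToPerm g t = s := by
    rw [RootPairing.weylGroup_apply_root] at h
    exact P.root.injective h
  refine weylGroup_ext fun v => ?_
  rw [mul_smul, mul_smul, simpleReflection_smul, simpleReflection_smul, smul_sub,
    weylGroup_smul_smul, h, ← hp, coroot'_weylGroup_smul]

@[simp] lemma simpleReflection_mul_self (b : P.Base) (s : b.support) :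
    simpleReflection b s * simpleReflection b s = 1 := by
  refine weylGroup_ext fun v => ?_
  rw [mul_smul]
  change P.reflection s (P.reflection s v) = v
  simp [RootPairing.reflection_same]

lemma simpleReflection_inv (b : P.Base) (s : b.support) :
    (simpleReflection b s)⁻¹ = simpleReflection b s :=
  inv_eq_of_mul_eq_one_left (simpleReflection_mul_self b s)

lemma simpleReflection_smul_self (b : P.Base) (s : b.support) :
    simpleReflection b s • P.root s = -P.root s := by
  change P.reflection s (P.root s) = _
  simp

lemma simpleReflection_smul_root (b : P.Base) (s t : b.support) :
    simpleReflection b s • P.root t = P.root t - P.pairing t s • P.root s := by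
  rw [simpleReflection_smul, RootPairing.root_coroot'_eq_pairing]

@[simp] lemma wordProd_nil (b : P.Base) : wordProd b [] = 1 := rfl

@[simp] lemma wordProd_cons (b : P.Base) (s : b.support) (w : List b.support) :
    wordProd b (s :: w) = simpleReflection b s * wordProd b w := by
  simp [wordProd]

@[simp] lemma wordProd_append (b : P.Base) (w w' : List b.support) :
    wordProd b (w ++ w') = wordProd b w * wordProd b w' := by
  simp [wordProd]

lemma wordProd_reverse (b : P.Base) (w : List b.support) :
    wordProd b w.reverse = (wordProd b w)⁻¹ := by
  induction w with
  | nil => simp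
  | cons s w ih => simp [ih, simpleReflection_inv]

lemma neg_mem_range_root {v : V} (h : v ∈ Set.range P.root) : -v ∈ Set.range P.root := by
  obtain ⟨i, rfl⟩ := h
  exact ⟨P.reflectionPerm i i, by simp⟩

lemma smul_mem_range_root (g : P.weylGroup) {v : V} (h : v ∈ Set.range P.root) :
    g • v ∈ Set.range P.root := by
  obtain ⟨i, rfl⟩ := h
  exact ⟨P.weylGroupToPerm g i, (RootPairing.weylGroup_apply_root P g i).symm⟩

section RootSystem

variable [P.IsRootSystem]

/-- The coefficient of a simple root in a vector of the root space. -/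
def coord (b : P.Base) (s : b.support) : V →ₗ[ℝ] ℝ := b.toWeightBasis.coord s

lemma coord_root_self (b : P.Base) (s : b.support) : coord b s (P.root s) = 1 := by
  simp [coord]

lemma coord_root_of_ne (b : P.Base) {s t : b.support} (h : t ≠ s) :
    coord b s (P.root t) = 0 := by
  simp [coord, h]

lemma coord_root_nonneg (b : P.Base) (s t : b.support) : 0 ≤ coord b s (P.root t) := by
  by_cases h : t = s
  · subst h; rw [coord_root_self]; exact zero_le_one
  · rw [coord_root_of_ne b h]

lemma eq_zero_of_coord (b : P.Base) {v : V} (h : ∀ s, coord b s v = 0) : v = 0 :=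
  b.toWeightBasis.ext_elem fun s => by simpa [coord] using h s

lemma coord_simpleReflection_smul_of_ne (b : P.Base) {s t : b.support} (h : t ≠ s) (v : V) :
    coord b s (simpleReflection b t • v) = coord b s v := by
  rw [simpleReflection_smul, map_sub, map_smul, coord_root_of_ne b h]
  simp

/-- A positive root, as a vector: a root all of whose coordinates in the base are nonnegative. -/
def IsPositiveRoot (b : P.Base) (v : V) : Prop :=
  v ∈ Set.range P.root ∧ ∀ s, 0 ≤ coord b s v

lemma isPositiveRoot_simple (b : P.Base) (s : b.support) : IsPositiveRoot b (P.root s) :=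
  ⟨⟨s, rfl⟩, fun t => coord_root_nonneg b t s⟩

lemma IsPositiveRoot.not_neg {b : P.Base} {v : V} (h : IsPositiveRoot b v) :
    ¬ IsPositiveRoot b (-v) := by
  intro h'
  have h0 : v = 0 := eq_zero_of_coord b fun s =>
    le_antisymm (by simpa using h'.2 s) (h.2 s)
  obtain ⟨i, hi⟩ := h.1
  exact P.ne_zero i (hi.trans h0)

lemma isPositiveRoot_or_neg (b : P.Base) {v : V} (h : v ∈ Set.range P.root) :
    IsPositiveRoot b v ∨ IsPositiveRoot b (-v) := by
  have key : ∀ f : ι → ℕ, ∀ s, 0 ≤ coord b s (∑ j ∈ b.support, f j • P.root j) := by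
    intro f s
    rw [map_sum]
    refine Finset.sum_nonneg fun j hj => ?_
    rw [map_nsmul]
    exact nsmul_nonneg (coord_root_nonneg b s ⟨j, hj⟩) _
  have hn := neg_mem_range_root h
  obtain ⟨i, rfl⟩ := h
  obtain ⟨f, -, hf | hf⟩ := b.exists_root_eq_sum_nat_or_neg i
  · exact Or.inl ⟨⟨i, rfl⟩, fun s => hf ▸ key f s⟩
  · refine Or.inr ⟨hn, fun s => ?_⟩
    rw [hf, neg_neg]
    exact key f s

lemma not_isPositiveRoot_iff (b : P.Base) {v : V} (h : v ∈ Set.range P.root) :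
    ¬ IsPositiveRoot b v ↔ IsPositiveRoot b (-v) := by
  constructor
  · exact (isPositiveRoot_or_neg b h).resolve_left
  · intro h1 h2
    exact h2.not_neg h1

variable [P.IsReduced]

/-- A simple reflection permutes the positive roots other than its simple root. -/
lemma eq_simple_of_reflection_neg (b : P.Base) {s : b.support} {v : V} (h : IsPositiveRoot b v)
    (h' : IsPositiveRoot b (-(simpleReflection b s • v))) : v = P.root s := by
  have hz : ∀ t, t ≠ s → coord b t v = 0 := by
    intro t ht
    have h1 := h.2 t
    have h2 := h'.2 t
    rw [map_neg, coord_simpleReflection_smul_of_ne b ht.symm] at h2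
    linarith
  have hv : v = coord b s v • P.root s := by
    refine b.toWeightBasis.ext_elem fun t => ?_
    change coord b t v = coord b t _
    by_cases ht : t = s
    · subst ht; rw [map_smul, coord_root_self]; simp
    · rw [hz t ht, map_smul, coord_root_of_ne b (Ne.symm ht)]; simp
  obtain ⟨⟨i, rfl⟩, hpos⟩ := h
  have hdep : ¬ LinearIndependent ℝ ![P.root i, P.root s] := by
    rw [LinearIndependent.pair_iff]
    intro H
    have := H 1 (-(coord b s (P.root i))) (by rw [neg_smul, ← hv]; simp)
    exact one_ne_zero this.1
  rcases RootPairing.IsReduced.eq_or_eq_neg i (s : ι) hdep with h1 | h1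
  · exact h1
  · have := hpos s
    rw [h1, map_neg, coord_root_self] at this
    linarith

end RootSystem

end

section

variable {ι V V' : Type*} [AddCommGroup V] [Module ℝ V] [AddCommGroup V'] [Module ℝ V']
  {P : RootPairing ι ℝ V V'}

/-! ### Length and the exchange property -/

/-- The simple reflections generate the Weyl group. -/
lemma exists_wordProd_eq [Finite ι] [P.IsCrystallographic] [P.IsReduced] (b : P.Base)
    (g : P.weylGroup) : ∃ w : List b.support, wordProd b w = g := by
  have hrefl : ∀ i : ι, ∃ w : List b.support,
      wordProd b w = RootPairing.weylGroup.ofIdx P i := by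
    intro i
    refine RootPairing.Base.induction_reflect (b := b) (p := fun i => ∃ w : List b.support,
      wordProd b w = RootPairing.weylGroup.ofIdx P i) i ?_ ?_ ?_
    · rintro i ⟨w, hw⟩
      refine ⟨w, hw.trans (weylGroup_ext fun v => ?_)⟩
      change P.reflection i v = P.reflection (P.reflectionPerm i i) v
      rw [RootPairing.reflection_reflectionPerm]
      simp [RootPairing.reflection_same]
    · intro i hi
      exact ⟨[⟨i, hi⟩], by simp [simpleReflection]⟩
    · rintro i j ⟨w, hw⟩ hj
      refine ⟨⟨j, hj⟩ :: w ++ [⟨j, hj⟩], weylGroup_ext fun v => ?_⟩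
      rw [wordProd_append, wordProd_cons, hw]
      change P.reflection j (P.reflection i (wordProd b [⟨j, hj⟩] • v)) =
        P.reflection (P.reflectionPerm j i) v
      rw [RootPairing.reflection_reflectionPerm, wordProd_cons, wordProd_nil, mul_one]
      rfl
  obtain ⟨g, hg⟩ := g
  induction hg using RootPairing.weylGroup.induction with
  | mem i => exact hrefl i
  | one => exact ⟨[], rfl⟩
  | mul x y hx hy h1 h2 =>
    obtain ⟨w1, hw1⟩ := h1
    obtain ⟨w2, hw2⟩ := h2
    exact ⟨w1 ++ w2, by rw [wordProd_append, hw1, hw2]; rfl⟩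

lemma coxeterLength_le (b : P.Base) (w : List b.support) :
    coxeterLength b (wordProd b w) ≤ w.length :=
  Nat.sInf_le ⟨w, rfl, rfl⟩

section

variable [Finite ι] [P.IsCrystallographic] [P.IsReduced]

lemma exists_isReducedExpression (b : P.Base) (g : P.weylGroup) :
    ∃ w : List b.support, IsReducedExpression b w g := by
  obtain ⟨w, hw⟩ := exists_wordProd_eq b g
  obtain ⟨w', h1, h2⟩ := Nat.sInf_mem (s := {k | ∃ w : List b.support, w.length = k ∧
    wordProd b w = g}) ⟨_, w, rfl, hw⟩
  exact ⟨w', h2, h1⟩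

lemma coxeterLength_inv_le (b : P.Base) (g : P.weylGroup) :
    coxeterLength b g⁻¹ ≤ coxeterLength b g := by
  obtain ⟨w, hw, hl⟩ := exists_isReducedExpression b g
  rw [← hl, ← w.length_reverse, ← hw, ← wordProd_reverse]
  exact coxeterLength_le b _

lemma coxeterLength_simpleReflection_mul_le (b : P.Base) (s : b.support) (g : P.weylGroup) :
    coxeterLength b (simpleReflection b s * g) ≤ coxeterLength b g + 1 := by
  obtain ⟨w, hw, hl⟩ := exists_isReducedExpression b g
  rw [← hl, ← hw, ← wordProd_cons]
  exact coxeterLength_le b (s :: w)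

lemma coxeterLength_le_simpleReflection_mul (b : P.Base) (s : b.support) (g : P.weylGroup) :
    coxeterLength b g ≤ coxeterLength b (simpleReflection b s * g) + 1 := by
  have h := coxeterLength_simpleReflection_mul_le b s (simpleReflection b s * g)
  rwa [← mul_assoc, simpleReflection_mul_self, one_mul] at h

end

section RootSystem

variable [P.IsRootSystem] [P.IsReduced]

/-- If the inverse of a word makes a positive root negative, then the root becomes the simple root
of one of the letters after the inverses of the preceding letters have been applied. -/
lemma exists_prefix_of_neg (b : P.Base) (w : List b.support) {v : V} (hv : IsPositiveRoot b v)
    (h : IsPositiveRoot b (-((wordProd b w)⁻¹ • v))) :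
    ∃ (w₁ : List b.support) (t : b.support) (w₂ : List b.support),
      w = w₁ ++ t :: w₂ ∧ wordProd b w₁ • P.root t = v := by
  induction w generalizing v with
  | nil => exact absurd (by simpa using h) hv.not_neg
  | cons t w ih =>
    by_cases ht : IsPositiveRoot b (simpleReflection b t • v)
    · obtain ⟨w₁, u, w₂, rfl, hw⟩ := ih ht (by
        rwa [wordProd_cons, mul_inv_rev, mul_smul, simpleReflection_inv] at h)
      refine ⟨t :: w₁, u, w₂, rfl, ?_⟩
      rw [wordProd_cons, mul_smul, hw, ← mul_smul, simpleReflection_mul_self, one_smul]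
    · rw [not_isPositiveRoot_iff b (smul_mem_range_root _ hv.1)] at ht
      exact ⟨[], t, w, rfl, by simpa using (eq_simple_of_reflection_neg b hv ht).symm⟩

variable [Finite ι] [P.IsCrystallographic]

lemma coxeterLength_simpleReflection_mul_lt_of_neg (b : P.Base) (s : b.support) (g : P.weylGroup)
    (h : IsPositiveRoot b (-(g⁻¹ • P.root s))) :
    coxeterLength b (simpleReflection b s * g) < coxeterLength b g := by
  obtain ⟨w, rfl, hl⟩ := exists_isReducedExpression b g
  obtain ⟨w₁, t, w₂, rfl, ht⟩ := exists_prefix_of_neg b w (isPositiveRoot_simple b s) h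
  have h1 : simpleReflection b s * wordProd b (w₁ ++ t :: w₂) = wordProd b (w₁ ++ w₂) := by
    rw [wordProd_append, wordProd_cons, ← mul_assoc, ← mul_assoc,
      ← mul_simpleReflection_of_smul_eq b ht, mul_assoc (wordProd b w₁),
      simpleReflection_mul_self, mul_one, wordProd_append]
  rw [h1, ← hl]
  refine (coxeterLength_le b _).trans_lt ?_
  simp

/-- A simple reflection lowers the length exactly when its simple root is an inversion. -/
lemma neg_of_coxeterLength_simpleReflection_mul_le (b : P.Base) (s : b.support) (g : P.weylGroup)
    (h : coxeterLength b (simpleReflection b s * g) ≤ coxeterLength b g) :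
    IsPositiveRoot b (-(g⁻¹ • P.root s)) := by
  rw [← not_isPositiveRoot_iff b (smul_mem_range_root _ ⟨s, rfl⟩)]
  intro hpos
  have := coxeterLength_simpleReflection_mul_lt_of_neg b s (simpleReflection b s * g) (by
    rwa [mul_inv_rev, mul_smul, simpleReflection_inv, simpleReflection_smul_self, smul_neg,
      neg_neg])
  rw [← mul_assoc, simpleReflection_mul_self, one_mul] at this
  exact absurd h this.not_ge

lemma eq_one_of_forall_isPositiveRoot (b : P.Base) (g : P.weylGroup)
    (h : ∀ s : b.support, IsPositiveRoot b (g • P.root s)) : g = 1 := by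
  obtain ⟨w, hw, hl⟩ := exists_isReducedExpression b g⁻¹
  cases w with
  | nil => simpa using hw.symm
  | cons s w =>
    exfalso
    refine (h s).not_neg ?_
    have := neg_of_coxeterLength_simpleReflection_mul_le b s g⁻¹ ?_
    · simpa using this
    · rw [← hl, ← hw, wordProd_cons, ← mul_assoc, simpleReflection_mul_self, one_mul]
      exact (coxeterLength_le b w).trans (by simp)

/-! ### The longest element -/

lemma coxeterLength_le_longestElement (b : P.Base) (g : P.weylGroup) :
    coxeterLength b g ≤ coxeterLength b (longestElement b) :=
  haveI := finite_weylGroup (P := P)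
  (Finite.exists_max (coxeterLength b)).choose_spec g

lemma smul_simple_neg_of_forall_le (b : P.Base) {g : P.weylGroup}
    (hg : ∀ h : P.weylGroup, coxeterLength b h ≤ coxeterLength b g) (s : b.support) :
    IsPositiveRoot b (-(g⁻¹ • P.root s)) :=
  neg_of_coxeterLength_simpleReflection_mul_le b s g (hg _)

lemma longestElement_smul_simple_neg (b : P.Base) (s : b.support) :
    IsPositiveRoot b (-(longestElement b • P.root s)) := by
  have := smul_simple_neg_of_forall_le b (g := (longestElement b)⁻¹) (fun h =>
    (coxeterLength_le_longestElement b h).trans (by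
      simpa using coxeterLength_inv_le b (longestElement b)⁻¹)) s
  simpa using this

lemma IsPositiveRoot.smul_neg_of_simple (b : P.Base) {g : P.weylGroup}
    (hg : ∀ s : b.support, IsPositiveRoot b (-(g • P.root s))) {v : V}
    (hv : IsPositiveRoot b v) : IsPositiveRoot b (-(g • v)) := by
  refine ⟨neg_mem_range_root (smul_mem_range_root g hv.1), fun t => ?_⟩
  have hsum := b.toWeightBasis.sum_repr v
  rw [← hsum]
  change 0 ≤ coord b t (-(actionMap g (∑ s, _)))
  rw [map_sum, ← Finset.sum_neg_distrib, map_sum]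
  refine Finset.sum_nonneg fun s _ => ?_
  rw [map_smul, ← smul_neg, map_smul]
  refine mul_nonneg (hv.2 s) ?_
  simpa using (hg s).2 t

@[simp] lemma longestElement_mul_self (b : P.Base) :
    longestElement b * longestElement b = 1 := by
  refine eq_one_of_forall_isPositiveRoot b _ fun s => ?_
  have := IsPositiveRoot.smul_neg_of_simple b (longestElement_smul_simple_neg b)
    (longestElement_smul_simple_neg b s)
  rwa [smul_neg, neg_neg, ← mul_smul] at this

lemma longestElement_inv (b : P.Base) : (longestElement b)⁻¹ = longestElement b :=
  inv_eq_of_mul_eq_one_left (longestElement_mul_self b)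

lemma longestElement_smul_smul (b : P.Base) (v : V) :
    longestElement b • longestElement b • v = v := by
  rw [← mul_smul, longestElement_mul_self, one_smul]

/-- The only positive root that the conjugate `w₀ s w₀` makes negative is `-w₀ αₛ`; as `w₀ s w₀`
is not the identity, that root is simple. -/
lemma exists_longestElement_smul_simple (b : P.Base) (s : b.support) :
    ∃ t : b.support, longestElement b • P.root s = -P.root t := by
  set w := longestElement b with hw
  by_contra! H
  have h1 : w * simpleReflection b s * w = 1 := by
    refine eq_one_of_forall_isPositiveRoot b _ fun t => ?_
    have hmem : (w * simpleReflection b s * w) • P.root t ∈ Set.range P.root :=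
      smul_mem_range_root _ ⟨t, rfl⟩
    by_contra hneg
    rw [not_isPositiveRoot_iff b hmem] at hneg
    have h2 := IsPositiveRoot.smul_neg_of_simple b (longestElement_smul_simple_neg b) hneg
    rw [smul_neg, neg_neg, mul_smul, mul_smul, longestElement_smul_smul] at h2
    have h3 := eq_simple_of_reflection_neg b (s := s) (longestElement_smul_simple_neg b t)
      (by rw [smul_neg, neg_neg]; exact h2)
    refine H t ?_
    rw [← h3, smul_neg, longestElement_smul_smul]
  have h2 : simpleReflection b s = 1 := by
    have := congrArg (fun x => w * x * w) h1
    simpa only [mul_assoc, hw, longestElement_mul_self, mul_one,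
      ← mul_assoc (longestElement b) (longestElement b), one_mul] using this
  have h3 := simpleReflection_smul_self b s
  rw [h2, one_smul] at h3
  exact (isPositiveRoot_simple b s).not_neg (h3 ▸ isPositiveRoot_simple b s)

/-- The involution `η` of the set of simple roots given by minus the longest element. -/
def opposition (b : P.Base) (s : b.support) : b.support :=
  (exists_longestElement_smul_simple b s).choose

lemma longestElement_smul_simple (b : P.Base) (s : b.support) :
    longestElement b • P.root s = -P.root (opposition b s) :=
  (exists_longestElement_smul_simple b s).choose_spec

lemma simple_injective (b : P.Base) {s t : b.support} (h : P.root s = P.root t) : s = t :=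
  Subtype.ext (P.root.injective h)

@[simp] lemma opposition_opposition (b : P.Base) (s : b.support) :
    opposition b (opposition b s) = s := by
  refine simple_injective b ?_
  have := longestElement_smul_smul b (P.root s)
  rw [longestElement_smul_simple, smul_neg, longestElement_smul_simple, neg_neg] at this
  exact this

lemma opposition_injective (b : P.Base) : Function.Injective (opposition b) :=
  Function.Involutive.injective (opposition_opposition b)

lemma mul_simpleReflection_of_smul_eq_neg (b : P.Base) {g : P.weylGroup} {s t : b.support}
    (h : g • P.root t = -P.root s) :
    g * simpleReflection b t = simpleReflection b s * g := by
  have h1 : (g * simpleReflection b t) • P.root t = P.root s := by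
    rw [mul_smul, simpleReflection_smul_self, smul_neg, h, neg_neg]
  have h2 := mul_simpleReflection_of_smul_eq b h1
  rw [mul_assoc, simpleReflection_mul_self, mul_one] at h2
  calc g * simpleReflection b t
      = simpleReflection b s * simpleReflection b s * (g * simpleReflection b t) := by
        rw [simpleReflection_mul_self, one_mul]
    _ = simpleReflection b s * g := by rw [mul_assoc, ← h2]

lemma simpleReflection_opposition (b : P.Base) (s : b.support) :
    simpleReflection b (opposition b s) =
      longestElement b * simpleReflection b s * longestElement b := by
  rw [mul_simpleReflection_of_smul_eq_neg b (longestElement_smul_simple b s), mul_assoc,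
    longestElement_mul_self, mul_one]

lemma pairing_opposition (b : P.Base) (s t : b.support) :
    P.pairing (opposition b s) (opposition b t) = P.pairing s t := by
  have h := congrArg (fun g : P.weylGroup => g • P.root s)
    (mul_simpleReflection_of_smul_eq_neg b (longestElement_smul_simple b t))
  simp only [mul_smul, simpleReflection_smul_root, longestElement_smul_simple, smul_sub, smul_neg,
    weylGroup_smul_smul] at h
  have h2 : (P.pairing (opposition b s) (opposition b t) - P.pairing s t) •
      P.root (opposition b t) = 0 := by
    simp only [sub_neg_eq_add, neg_sub, neg_add_eq_sub] at h
    rw [sub_smul, sub_eq_zero]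
    exact (sub_left_injective h).symm
  simpa [sub_eq_zero, P.ne_zero] using h2

/-! ### Commuting simple reflections -/

lemma simpleReflection_injective (b : P.Base) : Function.Injective (simpleReflection b) := by
  intro s t h
  by_contra hst
  have h1 := congrArg (coord b s) (congrArg (fun g : P.weylGroup => g • P.root s) h)
  simp only [simpleReflection_smul_self, map_neg, coord_root_self] at h1
  rw [coord_simpleReflection_smul_of_ne b (Ne.symm hst), coord_root_self] at h1
  norm_num at h1

lemma pairing_eq_zero_of_commute (b : P.Base) {s t : b.support} (hst : s ≠ t)
    (h : Commute (simpleReflection b s) (simpleReflection b t)) : P.pairing s t = 0 := by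
  have h1 := congrArg (coord b t) (congrArg (fun g : P.weylGroup => g • P.root s) h.eq)
  simp only [mul_smul, simpleReflection_smul_self, simpleReflection_smul_root b t s, smul_sub,
    weylGroup_smul_smul, smul_neg, map_sub, map_smul, map_neg, coord_root_self,
    coord_simpleReflection_smul_of_ne b hst, coord_root_of_ne b hst] at h1
  simp only [smul_eq_mul] at h1
  linarith

lemma commute_of_pairing_eq_zero (b : P.Base) {s t : b.support} (h : P.pairing s t = 0) :
    Commute (simpleReflection b s) (simpleReflection b t) := by
  have h1 : simpleReflection b t • P.root s = P.root s := by
    rw [simpleReflection_smul_root, h, zero_smul, sub_zero]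
  exact (mul_simpleReflection_of_smul_eq b h1).symm

lemma pairing_eq_zero_symm {i j : ι} (h : P.pairing i j = 0) : P.pairing j i = 0 :=
  P.pairing_eq_zero_iff.mp h

lemma commute_iff_pairing_eq_zero (b : P.Base) {s t : b.support} (hst : s ≠ t) :
    Commute (simpleReflection b s) (simpleReflection b t) ↔ P.pairing s t = 0 :=
  ⟨pairing_eq_zero_of_commute b hst, commute_of_pairing_eq_zero b⟩

end RootSystem

end

section

variable {ι V V' : Type*} [AddCommGroup V] [Module ℝ V] [AddCommGroup V'] [Module ℝ V']
  {P : RootPairing ι ℝ V V'}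

/-! ### Subwords of sequences of letters -/

open Classical in
/-- The factor contributed by position `k` of the sequence `q`: its letter if the position belongs
to the set `M` of used positions, and `1` otherwise. -/
def factor (b : P.Base) (q : ℕ → b.support) (M : Set ℕ) (k : ℕ) : P.weylGroup :=
  if k ∈ M then simpleReflection b (q k) else 1

/-- The product, from left to right, of the letters of `q` at the used positions before `k`. -/
def partialProd (b : P.Base) (q : ℕ → b.support) (M : Set ℕ) : ℕ → P.weylGroup
  | 0 => 1
  | k + 1 => partialProd b q M k * factor b q M k

/-- The root function of the subword of `q` at the positions in `M`. -/
def rootAt (b : P.Base) (q : ℕ → b.support) (M : Set ℕ) (k : ℕ) : V :=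
  partialProd b q M k • P.root (q k)

open Classical in
/-- The number of used positions before `n`. -/
def usedCount (M : Set ℕ) (n : ℕ) : ℕ := Nat.count (fun k => k ∈ M) n

/-- The letters of `q` at the positions of `M` before `n` form a reduced expression of `g`. -/
def IsReducedSubword (b : P.Base) (q : ℕ → b.support) (n : ℕ) (M : Set ℕ) (g : P.weylGroup) :
    Prop :=
  partialProd b q M n = g ∧ usedCount M n = coxeterLength b g

variable (b : P.Base) (q : ℕ → b.support) (M : Set ℕ)

@[simp] lemma usedCount_zero : usedCount M 0 = 0 := by simp [usedCount]

open Classical in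
lemma usedCount_succ (n : ℕ) : usedCount M (n + 1) = usedCount M n + if n ∈ M then 1 else 0 :=
  Nat.count_succ _ _

open Classical in
lemma usedCount_succ' (n : ℕ) :
    usedCount M (n + 1) = usedCount {k | k + 1 ∈ M} n + if 0 ∈ M then 1 else 0 :=
  Nat.count_succ' _ _

@[simp] lemma partialProd_zero : partialProd b q M 0 = 1 := rfl

lemma partialProd_succ (k : ℕ) :
    partialProd b q M (k + 1) = partialProd b q M k * factor b q M k := rfl

variable {q M} in
lemma factor_of_mem {k : ℕ} (h : k ∈ M) : factor b q M k = simpleReflection b (q k) := if_pos h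

variable {q M} in
lemma factor_of_notMem {k : ℕ} (h : k ∉ M) : factor b q M k = 1 := if_neg h

variable {q M} in
lemma partialProd_congr {q' : ℕ → b.support} {M' : Set ℕ} {n : ℕ} (hq : ∀ k < n, q k = q' k)
    (hM : ∀ k < n, k ∈ M ↔ k ∈ M') : partialProd b q M n = partialProd b q' M' n := by
  induction n with
  | zero => rfl
  | succ n ih =>
    classical
    rw [partialProd_succ, partialProd_succ,
      ih (fun k hk => hq k (by omega)) (fun k hk => hM k (by omega))]
    simp only [factor, hq n (by omega)]
    rw [if_congr (hM n (by omega)) rfl rfl]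

lemma partialProd_add (x k : ℕ) :
    partialProd b q M (x + k) = partialProd b q M x *
      partialProd b (fun l => q (x + l)) {l | x + l ∈ M} k := by
  induction k with
  | zero => simp
  | succ k ih => rw [← add_assoc, partialProd_succ, ih, partialProd_succ, mul_assoc]; rfl

lemma partialProd_succ' (k : ℕ) :
    partialProd b q M (k + 1) = factor b q M 0 *
      partialProd b (fun l => q (l + 1)) {l | l + 1 ∈ M} k := by
  rw [add_comm, partialProd_add, partialProd_succ, partialProd_zero, one_mul]
  simp only [add_comm 1]

lemma rootAt_succ (k : ℕ) :
    rootAt b q M (k + 1) =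
      factor b q M 0 • rootAt b (fun l => q (l + 1)) {l | l + 1 ∈ M} k := by
  rw [rootAt, partialProd_succ', mul_smul]
  rfl

lemma rootAt_zero : rootAt b q M 0 = P.root (q 0) := by
  rw [rootAt, partialProd_zero, one_smul]

lemma coxeterLength_partialProd_le (n : ℕ) :
    coxeterLength b (partialProd b q M n) ≤ usedCount M n := by
  suffices h : ∃ w : List b.support, w.length = usedCount M n ∧
      wordProd b w = partialProd b q M n by
    obtain ⟨w, h1, h2⟩ := h
    rw [← h1, ← h2]
    exact coxeterLength_le b w
  induction n with
  | zero => exact ⟨[], by simp⟩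
  | succ n ih =>
    obtain ⟨w, h1, h2⟩ := ih
    rw [partialProd_succ, usedCount_succ]
    by_cases hn : n ∈ M
    · exact ⟨w ++ [q n], by simp [h1, hn], by simp [h2, factor_of_mem b hn]⟩
    · exact ⟨w, by simp [h1, hn], by simp [h2, factor_of_notMem b hn]⟩

variable {q M}

lemma partialProd_diff_of_le {j k : ℕ} (h : k ≤ j) :
    partialProd b q (M \ {j}) k = partialProd b q M k :=
  partialProd_congr b (fun _ _ => rfl) fun l hl => by
    simp only [Set.mem_sdiff, Set.mem_singleton_iff, and_iff_left_iff_imp]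
    intro _
    omega

/-- Omitting a used letter multiplies the later partial products by the reflection in the root
of that letter. -/
lemma partialProd_diff_of_lt {j k : ℕ} (hj : j ∈ M) {c : P.weylGroup} (hc : c * c = 1)
    (h : partialProd b q M j * simpleReflection b (q j) = c * partialProd b q M j) (hk : j < k) :
    partialProd b q (M \ {j}) k = c * partialProd b q M k := by
  induction k, hk using Nat.le_induction with
  | base =>
    rw [partialProd_succ, partialProd_diff_of_le b le_rfl, factor_of_notMem b (by simp),
      partialProd_succ, factor_of_mem b hj, h, ← mul_assoc, hc, one_mul, mul_one]
  | succ k hk ih =>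
    rw [partialProd_succ, ih, partialProd_succ, mul_assoc]
    congr 2
    have : k ≠ j := by omega
    by_cases hkM : k ∈ M
    · rw [factor_of_mem b hkM, factor_of_mem b (M := M \ {j}) ⟨hkM, by simpa using this⟩]
    · rw [factor_of_notMem b hkM, factor_of_notMem b (M := M \ {j}) (fun hk' => hkM hk'.1)]

lemma count_diff {j n : ℕ} (hj : j ∈ M) (hn : j < n) :
    usedCount (M \ {j}) n + 1 = usedCount M n := by
  classical
  rw [usedCount, usedCount, Nat.count_eq_card_filter_range, Nat.count_eq_card_filter_range]
  have : (Finset.range n).filter (· ∈ M \ {j}) = ((Finset.range n).filter (· ∈ M)).erase j := by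
    ext k
    simp only [Finset.mem_filter, Finset.mem_range, Set.mem_sdiff, Set.mem_singleton_iff,
      Finset.mem_erase]
    tauto
  convert Finset.card_erase_add_one (s := (Finset.range n).filter (· ∈ M)) (a := j)
    (by simp [hj, hn]) using 2
  convert congrArg Finset.card this

section RootSystem

variable [P.IsRootSystem] [P.IsReduced]

/-- A positive root whose sign is changed by the inverse of a partial product is the root of one
of the used letters. -/
lemma exists_rootAt_eq_of_neg (n : ℕ) {v : V} (hv : IsPositiveRoot b v)
    (h : IsPositiveRoot b (-((partialProd b q M n)⁻¹ • v))) :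
    ∃ j < n, j ∈ M ∧ rootAt b q M j = v := by
  induction n with
  | zero => exact absurd (by simpa using h) hv.not_neg
  | succ n ih =>
    by_cases hn : IsPositiveRoot b (-((partialProd b q M n)⁻¹ • v))
    · obtain ⟨j, hj, h1⟩ := ih hn
      exact ⟨j, by omega, h1⟩
    · have hmem := smul_mem_range_root (partialProd b q M n)⁻¹ hv.1
      rw [← not_isPositiveRoot_iff b hmem, not_not] at hn
      rw [partialProd_succ, mul_inv_rev, mul_smul] at h
      by_cases hM : n ∈ M
      · rw [factor_of_mem b hM, simpleReflection_inv] at h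
        refine ⟨n, by omega, hM, ?_⟩
        rw [rootAt, ← eq_simple_of_reflection_neg b hn h, smul_inv_smul]
      · rw [factor_of_notMem b hM, inv_one, one_smul] at h
        exact absurd h hn.not_neg

variable [Finite ι] [P.IsCrystallographic]

/-- In a reduced subword the roots of the used letters are positive. -/
lemma IsReducedSubword.isPositiveRoot {n : ℕ} {g : P.weylGroup}
    (h : IsReducedSubword b q n M g) {j : ℕ} (hj : j < n) (hM : j ∈ M) :
    IsPositiveRoot b (rootAt b q M j) := by
  classical
  have hmem : rootAt b q M j ∈ Set.range P.root := smul_mem_range_root _ ⟨_, rfl⟩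
  by_contra hneg
  rw [not_isPositiveRoot_iff b hmem] at hneg
  obtain ⟨i, hi, hiM, hroot⟩ := exists_rootAt_eq_of_neg b (q := q) (M := M) j hneg (by
    rw [rootAt, smul_neg, inv_smul_smul, neg_neg]
    exact isPositiveRoot_simple b _)
  -- The letters at `i` and `j` have opposite roots, hence the same reflection `c`, and both can be
  -- omitted without changing the product.
  set c : P.weylGroup :=
    partialProd b q M i * simpleReflection b (q i) * (partialProd b q M i)⁻¹ with hcdef
  have hc : c * c = 1 := by
    simp only [hcdef, mul_assoc, inv_mul_cancel_left]
    rw [← mul_assoc (simpleReflection b (q i)), simpleReflection_mul_self, one_mul,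
      mul_inv_cancel]
  have hci : partialProd b q M i * simpleReflection b (q i) = c * partialProd b q M i := by
    simp [hcdef]
  have hcj : partialProd b q M j * simpleReflection b (q j) = c * partialProd b q M j := by
    have h1 : ((partialProd b q M i)⁻¹ * partialProd b q M j) • P.root (q j) =
        -P.root (q i) := by
      rw [mul_smul, ← rootAt, ← neg_eq_iff_eq_neg.mpr hroot, rootAt, smul_neg, inv_smul_smul]
    have h2 := mul_simpleReflection_of_smul_eq_neg b h1
    rw [mul_assoc, inv_mul_eq_iff_eq_mul] at h2
    rw [h2, hcdef]
    simp only [mul_assoc]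
  have hj' : j ∈ M \ {i} := ⟨hM, by simp; omega⟩
  have h1 : partialProd b q ((M \ {i}) \ {j}) n = partialProd b q M n := by
    rw [partialProd_diff_of_lt b hj' hc _ hj, partialProd_diff_of_lt b hiM hc hci (by omega),
      ← mul_assoc, hc, one_mul]
    rw [partialProd_diff_of_lt b hiM hc hci hi, mul_assoc, hcj]
  have h2 := coxeterLength_partialProd_le b q ((M \ {i}) \ {j}) n
  have h3 := count_diff hj' hj
  have h4 := count_diff hiM (n := n) (by omega)
  rw [h1, h.1] at h2
  have := h.2
  omega

/-! ### Invariance of the root function along the facets containing given positions -/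

lemma IsReducedSubword.succ_of_notMem {n : ℕ} {g : P.weylGroup}
    (h : IsReducedSubword b q (n + 1) M g) (h0 : 0 ∉ M) :
    IsReducedSubword b (fun l => q (l + 1)) n {l | l + 1 ∈ M} g := by
  classical
  obtain ⟨h1, h2⟩ := h
  rw [partialProd_succ', factor_of_notMem b h0, one_mul] at h1
  rw [usedCount_succ', if_neg h0] at h2
  exact ⟨h1, h2⟩

lemma IsReducedSubword.succ_of_mem {n : ℕ} {g : P.weylGroup}
    (h : IsReducedSubword b q (n + 1) M g) (h0 : 0 ∈ M) :
    IsReducedSubword b (fun l => q (l + 1)) n {l | l + 1 ∈ M} (simpleReflection b (q 0) * g) := by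
  classical
  obtain ⟨h1, h2⟩ := h
  rw [partialProd_succ', factor_of_mem b h0] at h1
  rw [usedCount_succ', if_pos h0] at h2
  have h3 : partialProd b (fun l => q (l + 1)) {l | l + 1 ∈ M} n =
      simpleReflection b (q 0) * g := by
    rw [← h1, ← mul_assoc, simpleReflection_mul_self, one_mul]
  refine ⟨h3, le_antisymm ?_ ?_⟩
  · have := coxeterLength_le_simpleReflection_mul b (q 0) g
    omega
  · rw [← h3]
    exact coxeterLength_partialProd_le b _ _ n

/-- Exchanging the letter `s`, put in front of a reduced subword of an element with left descent
`s`, for the letter of the subword whose root is `αₛ`. -/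
lemma IsReducedSubword.exists_exchange {n : ℕ} {g : P.weylGroup}
    (h : IsReducedSubword b q n M g) {s : b.support}
    (hs : coxeterLength b (simpleReflection b s * g) < coxeterLength b g) :
    ∃ j < n, j ∈ M ∧ rootAt b q M j = P.root s ∧
      IsReducedSubword b q n (M \ {j}) (simpleReflection b s * g) ∧
      (∀ k ≤ j, rootAt b q (M \ {j}) k = rootAt b q M k) ∧
      (∀ k, j < k → rootAt b q (M \ {j}) k = simpleReflection b s • rootAt b q M k) := by
  classical
  have hneg := neg_of_coxeterLength_simpleReflection_mul_le b s g hs.le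
  rw [← h.1] at hneg
  obtain ⟨j, hj, hjM, hroot⟩ := exists_rootAt_eq_of_neg b n (isPositiveRoot_simple b s) hneg
  have hc := mul_simpleReflection_of_smul_eq b hroot
  have hgt : ∀ k, j < k → partialProd b q (M \ {j}) k =
      simpleReflection b s * partialProd b q M k := fun k hk =>
    partialProd_diff_of_lt b hjM (simpleReflection_mul_self b s) hc hk
  refine ⟨j, hj, hjM, hroot, ⟨by rw [hgt n hj, h.1], ?_⟩, fun k hk => ?_, fun k hk => ?_⟩
  · have h1 := count_diff hjM hj
    have h2 := coxeterLength_partialProd_le b q (M \ {j}) n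
    rw [hgt n hj, h.1] at h2
    have h3 := h.2
    have h4 := coxeterLength_le_simpleReflection_mul b s g
    omega
  · rw [rootAt, partialProd_diff_of_le b hk, rootAt]
  · rw [rootAt, hgt k hk, mul_smul, rootAt]

lemma comp_simpleReflection_smul {φ : V →ₗ[ℝ] ℝ} {s : b.support} (h : φ (P.root s) = 0) (v : V) :
    φ (simpleReflection b s • v) = φ v := by
  rw [simpleReflection_smul, map_sub, map_smul, h]
  simp

variable (q) in
/-- If a linear form vanishes on the roots of the unused positions of one reduced subword for `g`,
then so it does for every other, and its values on the root function are the same for all of them.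

Two facets of the subword complex that differ by a flip have root functions that differ by the
reflection in the root of the exchanged position, which the linear form does not see. The
induction on the length of the word replaces the connectedness of the flip graph: facets that use
the first letter and facets that do not are joined by an exchange. -/
theorem IsReducedSubword.apply_rootAt_eq {n : ℕ} {g : P.weylGroup} {M₀ M : Set ℕ}
    (φ : V →ₗ[ℝ] ℝ) (h₀ : IsReducedSubword b q n M₀ g) (h : IsReducedSubword b q n M g)
    (hφ : ∀ k < n, k ∉ M₀ → φ (rootAt b q M₀ k) = 0) :
    (∀ k < n, k ∉ M → φ (rootAt b q M k) = 0) ∧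
      ∀ k < n, φ (rootAt b q M k) = φ (rootAt b q M₀ k) := by
  induction n generalizing q g M₀ M φ with
  | zero => simp
  | succ n ih =>
    set q' : ℕ → b.support := fun l => q (l + 1) with hq'
    set s := q 0 with hs
    set ψ : V →ₗ[ℝ] ℝ := φ ∘ₗ actionMap (simpleReflection b s) with hψ
    have root_notMem : ∀ {N : Set ℕ} (k : ℕ), 0 ∉ N →
        rootAt b q N (k + 1) = rootAt b q' {l | l + 1 ∈ N} k := by
      intro N k hN
      rw [rootAt_succ, factor_of_notMem b hN, one_smul]
    have root_mem : ∀ {N : Set ℕ} (k : ℕ), 0 ∈ N →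
        φ (rootAt b q N (k + 1)) = ψ (rootAt b q' {l | l + 1 ∈ N} k) := by
      intro N k hN
      rw [rootAt_succ, factor_of_mem b hN]
      rfl
    have drop : ∀ {N : Set ℕ}, IsReducedSubword b q (n + 1) N g → 0 ∈ N →
        coxeterLength b (simpleReflection b s * g) < coxeterLength b g := by
      classical
      intro N hN h0
      have h1 := (hN.succ_of_mem b h0).2
      have h2 := hN.2
      rw [usedCount_succ', if_pos h0] at h2
      rw [← hs] at h1
      omega
    by_cases hM₀ : 0 ∈ M₀ <;> by_cases hM : 0 ∈ M
    · obtain ⟨h1, h2⟩ := ih q' ψ (h₀.succ_of_mem b hM₀) (h.succ_of_mem b hM) (fun k hk hk0 => by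
        rw [← root_mem k hM₀]; exact hφ _ (by omega) hk0)
      refine ⟨fun k hk hkM => ?_, fun k hk => ?_⟩
      · cases k with
        | zero => exact absurd hM hkM
        | succ k => rw [root_mem k hM]; exact h1 k (by omega) hkM
      · cases k with
        | zero => rw [rootAt_zero, rootAt_zero]
        | succ k => rw [root_mem k hM, root_mem k hM₀]; exact h2 k (by omega)
    · obtain ⟨j, hj, hjM, hjs, hN, hle, hgt⟩ :=
        (h.succ_of_notMem b hM).exists_exchange b (drop h₀ hM₀)
      obtain ⟨h1, h2⟩ := ih q' ψ (h₀.succ_of_mem b hM₀) hN (fun k hk hk0 => by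
        rw [← root_mem k hM₀]; exact hφ _ (by omega) hk0)
      have hα : φ (P.root s) = 0 := by
        have := h1 j hj (by simp)
        rw [hle j le_rfl, hjs] at this
        simpa [hψ, simpleReflection_smul_self] using this
      have hψφ : ∀ v, ψ v = φ v := fun v => comp_simpleReflection_smul b hα v
      have hval : ∀ k, φ (rootAt b q' ({l | l + 1 ∈ M} \ {j}) k) = φ (rootAt b q M (k + 1)) := by
        intro k
        rw [root_notMem k hM]
        rcases le_or_gt k j with hk | hk
        · rw [hle k hk]
        · rw [hgt k hk, comp_simpleReflection_smul b hα]
      refine ⟨fun k hk hkM => ?_, fun k hk => ?_⟩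
      · cases k with
        | zero => rw [rootAt_zero]; exact hα
        | succ k =>
          rw [← hval, ← hψφ]
          exact h1 k (by omega) (fun hk' => hkM hk'.1)
      · cases k with
        | zero => rw [rootAt_zero, rootAt_zero]
        | succ k => rw [← hval, ← hψφ, h2 k (by omega), root_mem k hM₀]
    · obtain ⟨j, hj, hjM, hjs, hN, hle, hgt⟩ :=
        (h₀.succ_of_notMem b hM₀).exists_exchange b (drop h hM)
      have hα : φ (P.root s) = 0 := by
        have := hφ 0 (by omega) hM₀
        rwa [rootAt_zero] at this
      have hψφ : ∀ v, ψ v = φ v := fun v => comp_simpleReflection_smul b hα v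
      have hval : ∀ k, ψ (rootAt b q' ({l | l + 1 ∈ M₀} \ {j}) k) =
          φ (rootAt b q M₀ (k + 1)) := by
        intro k
        rw [root_notMem k hM₀, hψφ]
        rcases le_or_gt k j with hk | hk
        · rw [hle k hk]
        · rw [hgt k hk, comp_simpleReflection_smul b hα]
      obtain ⟨h1, h2⟩ := ih q' ψ hN (h.succ_of_mem b hM) (fun k hk hk0 => by
        by_cases hkj : k = j
        · rw [hkj, hle j le_rfl, hjs, hψφ, hα]
        · rw [hval]; exact hφ _ (by omega) (fun hk' => hk0 ⟨hk', hkj⟩))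
      refine ⟨fun k hk hkM => ?_, fun k hk => ?_⟩
      · cases k with
        | zero => exact absurd hM hkM
        | succ k => rw [root_mem k hM]; exact h1 k (by omega) hkM
      · cases k with
        | zero => rw [rootAt_zero, rootAt_zero]
        | succ k => rw [root_mem k hM, h2 k (by omega), hval]
    · obtain ⟨h1, h2⟩ := ih q' φ (h₀.succ_of_notMem b hM₀) (h.succ_of_notMem b hM)
        (fun k hk hk0 => by rw [← root_notMem k hM₀]; exact hφ _ (by omega) hk0)
      refine ⟨fun k hk hkM => ?_, fun k hk => ?_⟩
      · cases k with
        | zero =>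
          have := hφ 0 hk hM₀
          rwa [rootAt_zero] at this ⊢
        | succ k => rw [root_notMem k hM]; exact h1 k (by omega) hkM
      · cases k with
        | zero => rw [rootAt_zero, rootAt_zero]
        | succ k => rw [root_notMem k hM, root_notMem k hM₀]; exact h2 k (by omega)

end RootSystem

end

section

variable {ι V V' : Type*} [AddCommGroup V] [Module ℝ V] [AddCommGroup V'] [Module ℝ V']
  {P : RootPairing ι ℝ V V'}

/-! ### Rotation -/

/-- Positions of the sequence `q` that carry a letter which already occurred before. -/
def laterPositions {S : Type*} (q : ℕ → S) : Set ℕ := {k | ∃ l < k, q l = q k}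

/-- Between any two occurrences of the same letter, every letter that does not commute with it
occurs. This is how the words `⋯ w w w ⋯` enter the argument. -/
def Interlaced {b : P.Base} {α : Type*} [Preorder α] (q : α → b.support) : Prop :=
  ∀ ⦃z₁ z₂ : α⦄, z₁ < z₂ → q z₁ = q z₂ → ∀ s : b.support, s ≠ q z₁ →
    P.pairing s (q z₁) ≠ 0 → ∃ z, z₁ < z ∧ z < z₂ ∧ q z = s

variable (b : P.Base) {q : ℕ → b.support} {M : Set ℕ}

lemma partialProd_smul_of_pairing_eq_zero {k : ℕ} {t : b.support}
    (h : ∀ l < k, l ∈ M → P.pairing t (q l) = 0) :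
    partialProd b q M k • P.root t = P.root t := by
  induction k with
  | zero => simp
  | succ k ih =>
    rw [partialProd_succ, mul_smul]
    by_cases hk : k ∈ M
    · rw [factor_of_mem b hk, simpleReflection_smul_root, h k (by omega) hk, zero_smul, sub_zero]
      exact ih fun l hl => h l (by omega)
    · rw [factor_of_notMem b hk, one_smul]
      exact ih fun l hl => h l (by omega)

/-- Applying the letters of `q` one by one to a simple root. -/
lemma partialProd_smul_eq_add_sum (a n : ℕ) (t : b.support) [DecidablePred (· ∈ M)] :
    partialProd b q M (a + n) • P.root t = partialProd b q M a • P.root t +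
      ∑ z ∈ Finset.Ico a (a + n),
        if z ∈ M then (-P.pairing t (q z)) • rootAt b q M z else 0 := by
  induction n with
  | zero => simp
  | succ n ih =>
    rw [← add_assoc, partialProd_succ, mul_smul, Finset.sum_Ico_succ_top (by omega), ← add_assoc,
      ← ih]
    by_cases hk : a + n ∈ M
    · rw [factor_of_mem b hk, simpleReflection_smul_root, smul_sub, weylGroup_smul_smul, if_pos hk,
        ← rootAt, neg_smul, sub_eq_add_neg]
    · rw [factor_of_notMem b hk, one_smul, if_neg hk, add_zero]

/-- At the first occurrence of a letter, the root function of the set of later positions is the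
simple root of that letter. -/
lemma rootAt_laterPositions (hq : Interlaced q) {k : ℕ} (hk : k ∉ laterPositions q)
    (hM : M ⊆ laterPositions q) :
    rootAt b q M k = P.root (q k) := by
  refine partialProd_smul_of_pairing_eq_zero b fun l hl hlM => ?_
  obtain ⟨i, hi, hil⟩ := hM hlM
  by_contra hne
  obtain ⟨z, -, hz, hzk⟩ := hq hi hil (q k) (fun h => hk ⟨l, hl, by rw [h, hil]⟩)
    (by rwa [hil])
  exact hk ⟨z, by omega, hzk⟩

section RootSystem

variable [P.IsRootSystem] [P.IsReduced] [Finite ι] [P.IsCrystallographic]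

lemma coord_partialProd_smul_of_ne {n : ℕ} {t : b.support}
    (h : ∀ k < n, k ∈ M → q k ≠ t) (v : V) :
    coord b t (partialProd b q M n • v) = coord b t v := by
  induction n generalizing v with
  | zero => simp
  | succ n ih =>
    rw [partialProd_succ, mul_smul, ih fun k hk => h k (by omega)]
    by_cases hn : n ∈ M
    · rw [factor_of_mem b hn, coord_simpleReflection_smul_of_ne b (h n (by omega) hn)]
    · rw [factor_of_notMem b hn, one_smul]

lemma exists_mem_eq_of_longestElement {n : ℕ}
    (h : partialProd b q M n = longestElement b) (t : b.support) :
    ∃ k < n, k ∈ M ∧ q k = t := by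
  by_contra! H
  have h1 := coord_partialProd_smul_of_ne b H (P.root t)
  rw [h, coord_root_self, longestElement_smul_simple, map_neg] at h1
  have := coord_root_nonneg b t (opposition b t)
  linarith

variable {m : ℕ}

lemma partialProd_add_period (hq : ∀ k, q (k + m) = opposition b (q k))
    (hM : ∀ k, k + m ∈ M ↔ k ∈ M) (k : ℕ) :
    partialProd b q M (m + k) =
      partialProd b q M m * (longestElement b * partialProd b q M k * longestElement b) := by
  induction k with
  | zero => simp
  | succ k ih =>
    rw [← add_assoc, partialProd_succ, ih, partialProd_succ]
    by_cases hk : k ∈ M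
    · rw [factor_of_mem b hk, factor_of_mem b (by rw [add_comm]; exact (hM k).2 hk), add_comm m,
        hq, simpleReflection_opposition]
      simp only [mul_assoc]
      rw [← mul_assoc (longestElement b) (longestElement b), longestElement_mul_self, one_mul]
    · rw [factor_of_notMem b hk,
        factor_of_notMem b (by rw [add_comm]; exact fun h => hk ((hM k).1 h)), mul_one, mul_one]

lemma usedCount_rotate (hM : ∀ k, k + m ∈ M ↔ k ∈ M) (x : ℕ) :
    usedCount {l | x + l ∈ M} m = usedCount M m := by
  classical
  induction x with
  | zero => simp
  | succ x ih =>
    rw [← ih]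
    have h1 := usedCount_succ {l | x + l ∈ M} m
    rw [usedCount_succ'] at h1
    have h2 : (x + m ∈ M) ↔ (x + 0 ∈ M) := hM x
    simp only [Set.mem_ofPred_eq, h2] at h1
    rw [← Nat.add_right_cancel h1]
    congr 1
    ext l
    simp only [Set.mem_ofPred_eq]
    rw [add_right_comm, add_assoc]

/-- Moving an initial part of the word to the end, twisted by `η`, preserves reduced subwords of
the longest element. -/
lemma isReducedSubword_rotate_iff (hq : ∀ k, q (k + m) = opposition b (q k))
    (hM : ∀ k, k + m ∈ M ↔ k ∈ M) (x : ℕ) :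
    IsReducedSubword b (fun l => q (x + l)) m {l | x + l ∈ M} (longestElement b) ↔
      IsReducedSubword b q m M (longestElement b) := by
  rw [IsReducedSubword, IsReducedSubword, usedCount_rotate hM]
  refine and_congr_left' ?_
  have h1 := partialProd_add b q M x m
  rw [add_comm, partialProd_add_period b hq hM] at h1
  constructor
  · intro h
    rw [h] at h1
    have h2 : partialProd b q M m * longestElement b = 1 := by
      have h3 : partialProd b q M m * longestElement b *
          (partialProd b q M x * longestElement b) =
          1 * (partialProd b q M x * longestElement b) := by
        rw [one_mul]
        simpa only [mul_assoc] using h1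
      exact mul_right_cancel h3
    rw [← mul_one (partialProd b q M m), ← longestElement_mul_self b, ← mul_assoc, h2, one_mul]
  · intro h
    rw [h, ← mul_assoc, ← mul_assoc, longestElement_mul_self, one_mul] at h1
    exact (mul_left_cancel h1).symm

lemma rootAt_rotate (x k : ℕ) :
    rootAt b (fun l => q (x + l)) {l | x + l ∈ M} k =
      (partialProd b q M x)⁻¹ • rootAt b q M (x + k) := by
  rw [rootAt, rootAt, partialProd_add, ← mul_smul, inv_mul_cancel_left]

lemma rootAt_add_period (hq : ∀ k, q (k + m) = opposition b (q k))
    (hM : ∀ k, k + m ∈ M ↔ k ∈ M) (h : partialProd b q M m = longestElement b) (k : ℕ) :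
    rootAt b q M (k + m) = -rootAt b q M k := by
  rw [rootAt, add_comm k, partialProd_add_period b hq hM, h, ← mul_assoc, ← mul_assoc,
    longestElement_mul_self, one_mul, add_comm m, hq, mul_smul, longestElement_smul_simple,
    opposition_opposition, smul_neg, rootAt]

/-! ### The facet formed by the first occurrences of the letters -/

lemma isReducedSubword_laterPositions_succ (hint : Interlaced q) (hq : q m = opposition b (q 0))
    (h : IsReducedSubword b q m (laterPositions q) (longestElement b)) :
    IsReducedSubword b (fun l => q (l + 1)) m (laterPositions fun l => q (l + 1))
      (longestElement b) := by
  classical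
  set K := laterPositions q with hK
  have h0 : 0 ∉ K := fun ⟨l, hl, _⟩ => by omega
  obtain ⟨k, hkm, hkK, hks⟩ := exists_mem_eq_of_longestElement b h.1 (q 0)
  have hex : ∃ k, 0 < k ∧ q k = q 0 :=
    ⟨k, Nat.pos_of_ne_zero fun hk => h0 (hk ▸ hkK), hks⟩
  -- `j` is the second occurrence of the first letter.
  set j := Nat.find hex with hj
  obtain ⟨hj0, hjs⟩ := Nat.find_spec hex
  rw [← hj] at hj0 hjs
  have hmin : ∀ l, 0 < l → q l = q 0 → j ≤ l := fun l h1 h2 => Nat.find_min' hex ⟨h1, h2⟩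
  have hjm : j < m :=
    (hmin k (Nat.pos_of_ne_zero fun hk => h0 (hk ▸ hkK)) hks).trans_lt hkm
  have hjK : j ∈ K := ⟨0, hj0, hjs.symm⟩
  have hshift : ∀ l, l ∈ laterPositions (fun l => q (l + 1)) ↔ l + 1 ∈ K \ {j} := by
    intro l
    constructor
    · rintro ⟨i, hi, hil⟩
      refine ⟨⟨i + 1, by omega, hil⟩, fun hlj => ?_⟩
      have hlj : l + 1 = j := hlj
      have h1 : q (i + 1) = q (l + 1) := hil
      rw [hlj, hjs] at h1
      have := hmin (i + 1) (by omega) h1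
      omega
    · rintro ⟨⟨i, hi, hil⟩, hlj⟩
      have hlj : l + 1 ≠ j := hlj
      rcases Nat.eq_zero_or_pos i with rfl | hi0
      · have h1 := hmin (l + 1) (by omega) hil.symm
        refine ⟨j - 1, by omega, ?_⟩
        change q (j - 1 + 1) = q (l + 1)
        rw [Nat.sub_add_cancel hj0, hjs, hil]
      · refine ⟨i - 1, by omega, ?_⟩
        change q (i - 1 + 1) = q (l + 1)
        rw [Nat.sub_add_cancel hi0, hil]
  have hfix : partialProd b q K j • P.root (q j) = P.root (q 0) := by
    rw [hjs]
    refine partialProd_smul_of_pairing_eq_zero b fun l hl hlK => ?_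
    have hl0 : 0 < l := Nat.pos_of_ne_zero fun hl0 => h0 (hl0 ▸ hlK)
    obtain ⟨i, hi, hil⟩ := hlK
    by_contra hne
    obtain ⟨z, hz1, hz2, hz⟩ := hint hi hil (q 0)
      (fun hh => (hmin l hl0 (by rw [hh, hil])).not_gt hl) (by rwa [hil])
    have := hmin z (by omega) hz
    omega
  have hprod : ∀ n, partialProd b (fun l => q (l + 1)) (laterPositions fun l => q (l + 1)) n =
      partialProd b q (K \ {j}) (n + 1) := by
    intro n
    rw [partialProd_succ', factor_of_notMem b (fun hh => h0 hh.1), one_mul]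
    exact partialProd_congr b (fun _ _ => rfl) fun l _ => hshift l
  have hmK : m ∈ K := by
    obtain ⟨l, hl, -, hlq⟩ := exists_mem_eq_of_longestElement b h.1 (opposition b (q 0))
    exact ⟨l, hl, by rw [hlq, hq]⟩
  refine ⟨?_, ?_⟩
  · rw [hprod, partialProd_diff_of_lt b hjK (simpleReflection_mul_self b (q 0))
      (mul_simpleReflection_of_smul_eq b hfix) (by omega), partialProd_succ, h.1,
      factor_of_mem b hmK, hq, simpleReflection_opposition]
    simp only [mul_assoc]
    rw [← mul_assoc (longestElement b) (longestElement b), longestElement_mul_self, one_mul,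
      ← mul_assoc, simpleReflection_mul_self, one_mul]
  · have h1 : usedCount (laterPositions fun l => q (l + 1)) m = usedCount (K \ {j}) (m + 1) := by
      rw [usedCount_succ', if_neg (fun hh => h0 hh.1), add_zero]
      congr 1
      ext l
      exact hshift l
    have h2 := count_diff hjK (n := m + 1) (by omega)
    rw [usedCount_succ K, if_pos hmK] at h2
    have h3 := h.2
    omega

lemma isReducedSubword_laterPositions (hint : Interlaced q)
    (hq : ∀ k, q (k + m) = opposition b (q k))
    (h : IsReducedSubword b q m (laterPositions q) (longestElement b)) (x : ℕ) :
    IsReducedSubword b (fun l => q (x + l)) m (laterPositions fun l => q (x + l))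
      (longestElement b) := by
  induction x with
  | zero => simpa using h
  | succ x ih =>
    have h1 : (fun l => q (x + 1 + l)) = fun l => q (x + (l + 1)) :=
      funext fun l => by rw [add_assoc, add_comm 1]
    rw [h1]
    refine isReducedSubword_laterPositions_succ b (q := fun l => q (x + l)) ?_ ?_ ih
    · intro z₁ z₂ hz hzq s hs hp
      obtain ⟨z, h1, h2, h3⟩ := hint (Nat.add_lt_add_left hz x) hzq s hs hp
      obtain ⟨y, rfl⟩ : ∃ y, z = x + y := ⟨z - x, by omega⟩
      exact ⟨y, by omega, by omega, h3⟩
    · exact hq x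

end RootSystem

end

section

variable {ι V V' : Type*} [AddCommGroup V] [Module ℝ V] [AddCommGroup V'] [Module ℝ V']
  {P : RootPairing ι ℝ V V'} [P.IsRootSystem]

/-! ### Tropical mesh relations -/

/-- The root function of the facet of first occurrences, for the first `m` letters of the
nonnegative half of a bi-infinite sequence. -/
def sliceRoot (b : P.Base) (p : ℤ → b.support) (m : ℕ) (k : ℕ) : V :=
  rootAt b (fun l : ℕ => p l) (laterPositions (fun l : ℕ => p l) ∩ Set.Iio m) k

/-- The coefficient `{0 ‖ z}` of the position `z` of the bi-infinite sequence `p`, for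
`0 ≤ z ≤ m`. Outside of these positions the value is set to zero, so that the mesh relations remain
true across both ends of the window. -/
def meshFun (b : P.Base) (p : ℤ → b.support) (m : ℕ) (z : ℤ) : ℝ :=
  if z ≤ 0 then (if z = 0 then -1 else 0)
  else if z ≤ m then coord b (p 0) (sliceRoot b p m z.toNat) else 0

/-- A function on a window from `0` to `m` satisfies the tropical mesh relations when its values at
two consecutive occurrences of a letter add up to a combination, with Cartan coefficients, of the
positive parts of its values in between. -/
def IsMeshSolution {S : Type*} (a : S → S → ℝ) (p : ℤ → S) (m : ℤ) (D : ℤ → ℝ) : Prop :=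
  ∀ y z : ℤ, y < z → p y = p z → (∀ x ∈ Finset.Ioo y z, p x ≠ p z) → 0 < z → y < m →
    D y + D z = ∑ x ∈ Finset.Ioo y z, a (p z) (p x) * max (D x) 0

lemma meshFun_zero (b : P.Base) (p : ℤ → b.support) (m : ℕ) : meshFun b p m 0 = -1 := by
  simp [meshFun]

lemma meshFun_of_neg (b : P.Base) (p : ℤ → b.support) (m : ℕ) {z : ℤ} (hz : z < 0) :
    meshFun b p m z = 0 := by
  simp [meshFun, hz.le, hz.ne]

lemma meshFun_of_gt (b : P.Base) (p : ℤ → b.support) (m : ℕ) {z : ℤ} (hz : m < z) :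
    meshFun b p m z = 0 := by
  rw [meshFun, if_neg (by omega), if_neg (by omega)]

lemma meshFun_natCast (b : P.Base) (p : ℤ → b.support) (m : ℕ) {k : ℕ} (hk : 0 < k)
    (hkm : k ≤ m) : meshFun b p m k = coord b (p 0) (sliceRoot b p m k) := by
  rw [meshFun, if_neg (by omega), if_pos (by omega), Int.toNat_natCast]

variable [P.IsReduced] [Finite ι] [P.IsCrystallographic] (b : P.Base) {p : ℤ → b.support} {m : ℕ}

lemma Interlaced.natCast (hint : Interlaced p) : Interlaced (fun l : ℕ => p l) := by
  intro z₁ z₂ hz hzq s hs hp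
  obtain ⟨z, h1, h2, h3⟩ := hint (Int.ofNat_lt.2 hz) hzq s hs hp
  obtain ⟨k, rfl⟩ := Int.eq_ofNat_of_zero_le (a := z) (by omega)
  exact ⟨k, by omega, by omega, h3⟩

lemma IsReducedSubword.inter_Iio {q : ℕ → b.support} {M : Set ℕ} {g : P.weylGroup}
    (h : IsReducedSubword b q m M g) : IsReducedSubword b q m (M ∩ Set.Iio m) g := by
  classical
  refine ⟨?_, ?_⟩
  · rw [← h.1]
    exact partialProd_congr b (fun _ _ => rfl) fun k hk => by simp [hk]
  · rw [← h.2, usedCount, usedCount, Nat.count_eq_card_filter_range, Nat.count_eq_card_filter_range]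
    congr 1
    ext k
    simp only [Finset.mem_filter, Finset.mem_range, Set.mem_inter_iff, Set.mem_Iio]
    tauto

lemma sliceRoot_of_notMem (hint : Interlaced p) {k : ℕ}
    (hk : k ∉ laterPositions (fun l : ℕ => p l)) : sliceRoot b p m k = P.root (p k) :=
  rootAt_laterPositions b hint.natCast hk Set.inter_subset_left

lemma sliceRoot_of_le (h : IsReducedSubword b (fun l : ℕ => p l) m
    (laterPositions fun l : ℕ => p l) (longestElement b)) {k : ℕ} (hk : m ≤ k) :
    sliceRoot b p m k = -P.root (opposition b (p k)) := by
  have h1 : partialProd b (fun l : ℕ => p l) (laterPositions (fun l : ℕ => p l) ∩ Set.Iio m) k =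
      longestElement b := by
    induction k, hk using Nat.le_induction with
    | base => exact (h.inter_Iio b).1
    | succ k hk ih => rw [partialProd_succ, ih, factor_of_notMem b (by simp; omega), mul_one]
  rw [sliceRoot, rootAt, h1, longestElement_smul_simple]

lemma meshFun_nonneg_of_mem (h : IsReducedSubword b (fun l : ℕ => p l) m
    (laterPositions fun l : ℕ => p l) (longestElement b)) {k : ℕ}
    (hk : k ∈ laterPositions (fun l : ℕ => p l)) (hkm : k < m) :
    meshFun b p m k = coord b (p 0) (sliceRoot b p m k) ∧ 0 ≤ meshFun b p m k := by
  have hk0 : 0 < k := by obtain ⟨l, hl, -⟩ := hk; omega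
  have h1 := meshFun_natCast b p m hk0 hkm.le
  refine ⟨h1, ?_⟩
  rw [h1]
  exact ((h.inter_Iio b).isPositiveRoot b hkm ⟨hk, hkm⟩).2 _

lemma meshFun_of_notMem (hint : Interlaced p) {k : ℕ}
    (hk : k ∉ laterPositions (fun l : ℕ => p l)) (hk0 : 0 < k) : meshFun b p m k = 0 := by
  rcases le_or_gt k m with hkm | hkm
  · rw [meshFun_natCast b p m hk0 hkm, sliceRoot_of_notMem b hint hk]
    exact coord_root_of_ne b fun h0 => hk ⟨0, hk0, by simp [h0]⟩
  · exact meshFun_of_gt b p m (by omega)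

lemma meshFun_period (hper : ∀ z, p (z + m) = opposition b (p z)) (hm : 0 < m)
    (h : IsReducedSubword b (fun l : ℕ => p l) m
      (laterPositions fun l : ℕ => p l) (longestElement b)) : meshFun b p m m = -1 := by
  rw [meshFun_natCast b p m hm le_rfl, sliceRoot_of_le b h le_rfl, ← zero_add (m : ℤ), hper,
    opposition_opposition, map_neg, coord_root_self]

lemma meshFun_nonpos_of_notMem (hint : Interlaced p)
    (hper : ∀ z, p (z + m) = opposition b (p z)) (h : IsReducedSubword b (fun l : ℕ => p l) m
      (laterPositions fun l : ℕ => p l) (longestElement b)) {k : ℕ}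
    (hk : k ∉ laterPositions (fun l : ℕ => p l) ∩ Set.Iio m) : max (meshFun b p m k) 0 = 0 := by
  refine max_eq_right ?_
  rcases Nat.eq_zero_or_pos k with rfl | hk0
  · rw [Nat.cast_zero, meshFun_zero]; norm_num
  rcases lt_trichotomy k m with hkm | rfl | hkm
  · exact (meshFun_of_notMem b hint (fun h => hk ⟨h, hkm⟩) hk0).le
  · rw [meshFun_period b hper hk0 h]; norm_num
  · exact (meshFun_of_gt b p m (by omega)).le

/-- The mesh relations hold for the coefficients `{0 ‖ z}`. Inside the window they come from
comparing the values of the root function at consecutive occurrences of a letter. -/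
lemma isMeshSolution_meshFun (hint : Interlaced p) (hper : ∀ z, p (z + m) = opposition b (p z))
    (h : IsReducedSubword b (fun l : ℕ => p l) m
      (laterPositions fun l : ℕ => p l) (longestElement b)) :
    IsMeshSolution (fun s t : b.support => -P.pairing s t) p m (meshFun b p m) := by
  classical
  intro y z hyz hp hbetween hz hy
  simp only [Finset.mem_Ioo] at hbetween
  obtain ⟨c, rfl⟩ := Int.eq_ofNat_of_zero_le (a := z) (by omega)
  set K := laterPositions (fun l : ℕ => p l) with hK
  rcases lt_or_ge y 0 with hy0 | hy0
  · have hcm : c < m := by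
      obtain ⟨k, hk, -, hkc⟩ := exists_mem_eq_of_longestElement b h.1 (p c)
      by_contra hcm
      exact hbetween k ⟨by omega, by omega⟩ hkc
    have hcK : c ∉ K := fun ⟨l, hl, hlc⟩ => hbetween l ⟨by omega, by omega⟩ hlc
    rw [meshFun_of_neg b p m hy0, meshFun_of_notMem b hint hcK (by omega), add_zero]
    refine (Finset.sum_eq_zero fun x hx => ?_).symm
    rw [Finset.mem_Ioo] at hx
    rcases lt_or_ge x 0 with hx0 | hx0
    · rw [meshFun_of_neg b p m hx0]; simp
    obtain ⟨k, rfl⟩ := Int.eq_ofNat_of_zero_le hx0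
    by_cases hk : k ∈ K
    · obtain ⟨i, hi, hik⟩ := hk
      have h0 : P.pairing (p c) (p k) = 0 := by
        by_contra hne
        obtain ⟨l, hl1, hl2, hl⟩ := hint.natCast b hi hik (p c)
          (fun hh => hbetween k hx (by rw [hh]; exact hik.symm)) (by simpa only [hik] using hne)
        exact hbetween l ⟨by omega, by omega⟩ hl
      simp only [h0]; simp
    · rw [meshFun_nonpos_of_notMem b hint hper h (fun hh => hk hh.1), mul_zero]
  · obtain ⟨a, rfl⟩ := Int.eq_ofNat_of_zero_le hy0
    have ham : a < m := by omega
    obtain ⟨n, rfl⟩ : ∃ n, c = a + 1 + n := ⟨c - (a + 1), by omega⟩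
    set c := a + 1 + n with hc
    have hlin := partialProd_smul_eq_add_sum b (q := fun l : ℕ => p l) (M := K ∩ Set.Iio m)
      (a + 1) n (p c)
    rw [← hc] at hlin
    have hlin' := congrArg (coord b (p 0)) hlin
    rw [map_add, map_sum] at hlin'
    have hsum : ∑ x ∈ Finset.Ioo (a : ℤ) c, -P.pairing (p c) (p x) * max (meshFun b p m x) 0 =
        ∑ x ∈ Finset.Ico (a + 1) c, coord b (p 0) (if x ∈ K ∩ Set.Iio m then
          (-P.pairing (p c) (p x)) • rootAt b (fun l : ℕ => p l) (K ∩ Set.Iio m) x else 0) := by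
      refine (Finset.sum_nbij (fun k : ℕ => (k : ℤ)) ?_ ?_ ?_ ?_).symm
      · intro k hk
        simp only [Finset.mem_Ico] at hk
        simp only [Finset.mem_Ioo]
        omega
      · exact fun _ _ _ _ hh => Int.ofNat_injective hh
      · intro x hx
        simp only [Finset.coe_Ioo, Set.mem_Ioo] at hx
        refine ⟨x.toNat, ?_, by simp; omega⟩
        simp only [Finset.coe_Ico, Set.mem_Ico]
        omega
      · intro k hk
        by_cases hkK : k ∈ K ∩ Set.Iio m
        · obtain ⟨h1, h2⟩ := meshFun_nonneg_of_mem b h hkK.1 hkK.2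
          rw [if_pos hkK, max_eq_left h2, h1, map_smul, smul_eq_mul]
          rfl
        · rw [if_neg hkK, meshFun_nonpos_of_notMem b hint hper h hkK]; simp
    have hDc : meshFun b p m c = coord b (p 0) (sliceRoot b p m c) := by
      rcases le_or_gt c m with hcm | hcm
      · exact meshFun_natCast b p m (by omega) hcm
      · rw [meshFun_of_gt b p m (by omega), sliceRoot_of_le b h hcm.le, map_neg,
          coord_root_of_ne b, neg_zero]
        intro h0
        refine hbetween m ⟨by omega, by omega⟩ ?_
        rw [← zero_add (m : ℤ), hper, ← h0, opposition_opposition]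
    have hDa : meshFun b p m a = -coord b (p 0) (partialProd b (fun l : ℕ => p l)
        (K ∩ Set.Iio m) (a + 1) • P.root (p c)) := by
      rw [← hp, partialProd_succ, mul_smul]
      by_cases haK : a ∈ K
      · rw [factor_of_mem b (M := K ∩ Set.Iio m) ⟨haK, ham⟩, simpleReflection_smul_self, smul_neg,
          map_neg, neg_neg,
          (meshFun_nonneg_of_mem b h haK ham).1]
        rfl
      · rw [factor_of_notMem b (M := K ∩ Set.Iio m) (fun hh => haK hh.1), one_smul]
        change _ = -coord b (p 0) (sliceRoot b p m a)
        rw [sliceRoot_of_notMem b hint haK]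
        rcases Nat.eq_zero_or_pos a with rfl | ha0
        · rw [Nat.cast_zero, meshFun_zero, coord_root_self]
        · rw [meshFun_of_notMem b hint haK ha0, coord_root_of_ne b, neg_zero]
          exact fun h0 => haK ⟨0, ha0, by simp [h0]⟩
    rw [hsum, hDc, hDa]
    change _ + coord b (p 0) (partialProd b (fun l : ℕ => p l) (K ∩ Set.Iio m) c •
      P.root (p c)) = _
    rw [hlin']
    ring

/-! ### Uniqueness of solutions of the mesh relations -/

/-- Two solutions of the mesh relations that vanish to the left of `0` and agree at `0` correspond
to each other under every bijection of positions that preserves the order of interacting letters. -/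
theorem IsMeshSolution.eq_of_equiv {S S' : Type*} [Finite S] {a : S → S → ℝ} {a' : S' → S' → ℝ}
    {p : ℤ → S} {p' : ℤ → S'} {m m' : ℤ} {D D' : ℤ → ℝ}
    (hD : IsMeshSolution a p m D) (hD' : IsMeshSolution a' p' m' D')
    (hneg : ∀ z < 0, D z = 0) (hneg' : ∀ z < 0, D' z = 0) (E : ℤ ≃ ℤ) (hE0 : E 0 = 0)
    (h0 : D 0 = D' 0) (hletter : ∀ y z, p y = p z ↔ p' (E y) = p' (E z))
    (ha : ∀ y z, a (p y) (p z) = a' (p' (E y)) (p' (E z)))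
    (hlt : ∀ y z, (p y = p z ∨ a (p y) (p z) ≠ 0) → (y < z ↔ E y < E z))
    (hlow : ∀ z N, ∃ y < N, p y = p z) (hlow' : ∀ z N, ∃ y < N, p' y = p' z) :
    ∀ y, y < m → E y < m' → D y = D' (E y) := by
  have hinj : ∀ y z, y ≠ z → E y ≠ E z := fun y z h hh => h (E.injective hh)
  -- Far enough to the left, `E` takes negative values.
  obtain ⟨B, hB⟩ : ∃ B : ℤ, ∀ y ≤ B, E y < 0 := by
    have hs : ∀ s : S, ∃ B : ℤ, ∀ y ≤ B, p y = s → E y < 0 := by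
      intro s
      by_cases hs : ∃ z, p z = s
      · obtain ⟨z, rfl⟩ := hs
        obtain ⟨y', hy', hy'z⟩ := hlow' (E z) 0
        refine ⟨E.symm y', fun y hy hyz => ?_⟩
        rcases hy.eq_or_lt with rfl | hy
        · simpa using hy'
        · have h1 : p (E.symm y') = p z := by
            rw [hletter, E.apply_symm_apply, hy'z]
          have h2 := (hlt y (E.symm y') (Or.inl (hyz.trans h1.symm))).1 hy
          rw [E.apply_symm_apply] at h2
          omega
      · exact ⟨0, fun y _ hy => absurd ⟨y, hy⟩ hs⟩
    choose f hf using hs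
    obtain ⟨B, hB⟩ := (Set.finite_range f).bddBelow
    exact ⟨B, fun y hy => hf (p y) y (hy.trans (hB ⟨p y, rfl⟩)) rfl⟩
  -- The preceding occurrence of the letter at `z`, and its image.
  have hprev : ∀ z, ∃ y < z, p y = p z ∧ (∀ x ∈ Finset.Ioo y z, p x ≠ p z) := by
    intro z
    obtain ⟨y₀, hy₀, hy₀z⟩ := hlow z z
    obtain ⟨y, ⟨hy, hyz⟩, hmax⟩ := Int.exists_greatest_of_bdd (P := fun y => y < z ∧ p y = p z)
      ⟨z, fun y hy => hy.1.le⟩ ⟨y₀, hy₀, hy₀z⟩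
    refine ⟨y, hy, hyz, fun x hx hxz => ?_⟩
    rw [Finset.mem_Ioo] at hx
    have := hmax x ⟨hx.2, hxz⟩
    omega
  have hmem : ∀ {y z : ℤ}, p y = p z → ∀ x, a (p z) (p x) ≠ 0 →
      (x ∈ Finset.Ioo y z ↔ E x ∈ Finset.Ioo (E y) (E z)) := by
    intro y z hyz x hx
    rw [Finset.mem_Ioo, Finset.mem_Ioo, hlt y x (Or.inr (by rwa [hyz]))]
    refine and_congr_right fun _ => ?_
    have h1 := hlt z x (Or.inr hx)
    rcases eq_or_ne x z with rfl | hxz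
    · simp
    · have h2 := hinj x z hxz
      omega
  -- Strong induction, starting to the left of the supports of both functions.
  suffices H : ∀ n : ℕ, ∀ y, y ≤ min B (-1) + n → y < m → E y < m' → D y = D' (E y) by
    intro y
    exact H (y - min B (-1)).toNat y (by omega)
  intro n
  induction n with
  | zero =>
    intro y hy _ _
    rw [hneg y (by omega), hneg' _ (hB y (by omega))]
  | succ n ih =>
    intro z hzn hzm hzm'
    by_cases hz0 : z = 0
    · rw [hz0, hE0, h0]
    have hEz0 : E z ≠ 0 := fun hh => hz0 (E.injective (hh.trans hE0.symm))
    obtain ⟨y, hyz, hpy, hbetween⟩ := hprev z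
    have hE_lt : E y < E z := (hlt y z (Or.inl hpy)).1 hyz
    have hDy : D y = D' (E y) := ih y (by omega) (by omega) (by omega)
    have hDx : ∀ x ∈ Finset.Ioo y z, a (p z) (p x) ≠ 0 → D x = D' (E x) := by
      intro x hx hax
      have h2 := (hmem hpy x hax).1 hx
      rw [Finset.mem_Ioo] at hx h2
      exact ih x (by omega) (by omega) (by omega)
    have hpy' : p' (E y) = p' (E z) := (hletter y z).1 hpy
    have hbetween' : ∀ x ∈ Finset.Ioo (E y) (E z), p' x ≠ p' (E z) := by
      intro x hx hxz
      obtain ⟨x, rfl⟩ := E.surjective x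
      rw [Finset.mem_Ioo] at hx
      have h1 := (hletter x z).2 hxz
      refine hbetween x ?_ h1
      rw [Finset.mem_Ioo, hlt y x (Or.inl (hpy.trans h1.symm)), hlt x z (Or.inl h1)]
      exact hx
    have hsum : ∑ x ∈ Finset.Ioo y z, a (p z) (p x) * max (D x) 0 =
        ∑ x ∈ Finset.Ioo (E y) (E z), a' (p' (E z)) (p' x) * max (D' x) 0 := by
      refine Finset.sum_bij_ne_zero (fun x _ _ => E x) ?_ ?_ ?_ ?_
      · exact fun x hx hne => (hmem hpy x (left_ne_zero_of_mul hne)).1 hx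
      · exact fun x _ _ x' _ _ hh => E.injective hh
      · intro x' hx' hne
        obtain ⟨x, rfl⟩ := E.surjective x'
        have hax : a (p z) (p x) ≠ 0 := by rw [ha]; exact left_ne_zero_of_mul hne
        have hx := (hmem hpy x hax).2 hx'
        exact ⟨x, hx, by rw [ha, hDx x hx hax]; exact hne, rfl⟩
      · intro x hx hne
        rw [ha, hDx x hx (left_ne_zero_of_mul hne)]
    rcases lt_or_ge z 0 with hz | hz <;> rcases lt_or_ge (E z) 0 with hEz | hEz
    · rw [hneg z hz, hneg' _ hEz]
    · -- The sum for `z` is empty of positive terms, hence so is the one for `E z`.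
      have h1 := hD' (E y) (E z) hE_lt hpy' hbetween' (by omega) (by omega)
      rw [← hsum, ← hDy, hneg y (by omega), zero_add] at h1
      rw [h1, hneg z hz]
      refine (Finset.sum_eq_zero fun x hx => ?_).symm
      rw [Finset.mem_Ioo] at hx
      rw [hneg x (by omega)]; simp
    · have h1 := hD y z hyz hpy hbetween (by omega) (by omega)
      rw [hsum, hDy, hneg' (E y) (by omega), zero_add] at h1
      rw [h1, hneg' _ hEz]
      refine Finset.sum_eq_zero fun x hx => ?_
      rw [Finset.mem_Ioo] at hx
      rw [hneg' x (by omega)]; simp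
    · have h1 := hD y z hyz hpy hbetween (by omega) (by omega)
      have h2 := hD' (E y) (E z) hE_lt hpy' hbetween' (by omega) (by omega)
      rw [← hsum, ← h1, hDy] at h2
      exact (add_left_cancel h2).symm

/-- The mirror image of a solution of the mesh relations is a solution. -/
lemma IsMeshSolution.reverse {S : Type*} {a : S → S → ℝ} {p : ℤ → S} {m : ℤ} {D : ℤ → ℝ}
    (hD : IsMeshSolution a p m D) :
    IsMeshSolution a (fun z => p (m - z)) m (fun z => D (m - z)) := by
  intro y z hyz hp hbetween hz hy
  replace hp : p (m - y) = p (m - z) := hp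
  rw [add_comm, hD (m - z) (m - y) (by omega) hp.symm ?_ (by omega) (by omega)]
  · rw [hp]
    refine Finset.sum_nbij' (fun x => m - x) (fun x => m - x) ?_ ?_ ?_ ?_ ?_ <;> intro x hx <;>
      simp only [Finset.mem_Ioo] at hx ⊢ <;> first | omega | simp
  · intro x hx
    rw [Finset.mem_Ioo] at hx
    have := hbetween (m - x) (by rw [Finset.mem_Ioo]; omega)
    rw [hp]
    simpa using this

end

section

variable {ι V V' : Type*} [AddCommGroup V] [Module ℝ V] [AddCommGroup V'] [Module ℝ V']
  {P : RootPairing ι ℝ V V'}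

/-! ### Coxeter words and their sorting words -/

lemma usedCount_add (M : Set ℕ) (x k : ℕ) :
    usedCount M (x + k) = usedCount M x + usedCount {l | x + l ∈ M} k := by
  classical
  exact Nat.count_add _ _ _

lemma partialProd_of_forall_notMem (b : P.Base) (q : ℕ → b.support) {M : Set ℕ} {n : ℕ}
    (h : ∀ k < n, k ∉ M) : partialProd b q M n = 1 := by
  induction n with
  | zero => rfl
  | succ n ih =>
    rw [partialProd_succ, ih fun k hk => h k (by omega), factor_of_notMem b (h n (by omega)),
      mul_one]

lemma usedCount_of_forall_notMem {M : Set ℕ} {n : ℕ} (h : ∀ k < n, k ∉ M) :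
    usedCount M n = 0 := by
  induction n with
  | zero => simp
  | succ n ih => rw [usedCount_succ, ih fun k hk => h k (by omega), if_neg (h n (by omega))]

lemma partialProd_eq_wordProd (b : P.Base) (w : List b.support) (q : ℕ → b.support) (M : Set ℕ)
    (hM : ∀ k < w.length, k ∈ M) (hq : ∀ (k : ℕ) (hk : k < w.length), q k = w[k]) :
    partialProd b q M w.length = wordProd b w ∧ usedCount M w.length = w.length := by
  induction w generalizing q M with
  | nil => simp
  | cons s w ih =>
    obtain ⟨h1, h2⟩ := ih (fun l => q (l + 1)) {l | l + 1 ∈ M}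
      (fun k hk => hM (k + 1) (by simpa using hk))
      (fun k hk => hq (k + 1) (by simpa using hk))
    rw [List.length_cons, partialProd_succ', usedCount_succ', h1, h2, wordProd_cons,
      factor_of_mem b (hM 0 (by simp)), hq 0 (by simp), if_pos (hM 0 (by simp))]
    simp

lemma exists_le_of_forall_length_eq {α : Type*} [LinearOrder α] [WellFoundedLT α] (n : ℕ)
    (A : Set (List α)) (hA : A.Nonempty) (hlen : ∀ p ∈ A, p.length = n) :
    ∃ p ∈ A, ∀ q ∈ A, p ≤ q := by
  induction n generalizing A with
  | zero =>
    obtain ⟨p, hp⟩ := hA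
    refine ⟨p, hp, fun q hq => ?_⟩
    rw [List.length_eq_zero_iff.1 (hlen p hp), List.length_eq_zero_iff.1 (hlen q hq)]
  | succ n ih =>
    have hcons : ∀ p ∈ A, ∃ a t, p = a :: t := fun p hp => by
      have := hlen p hp
      cases p with
      | nil => simp at this
      | cons a t => exact ⟨a, t, rfl⟩
    have hheads : {a : α | ∃ t, a :: t ∈ A}.Nonempty := by
      obtain ⟨p, hp⟩ := hA
      obtain ⟨a, t, rfl⟩ := hcons p hp
      exact ⟨a, t, hp⟩
    obtain ⟨a, ⟨t₀, ht₀⟩, hmin⟩ := WellFounded.has_min wellFounded_lt _ hheads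
    obtain ⟨t, ht, htmin⟩ := ih {t | a :: t ∈ A} ⟨t₀, ht₀⟩
      fun t ht => by simpa using hlen _ ht
    refine ⟨a :: t, ht, fun q hq => ?_⟩
    obtain ⟨a', t', rfl⟩ := hcons q hq
    rcases (not_lt.1 (hmin a' ⟨t', hq⟩)).lt_or_eq with h | rfl
    · exact le_of_lt (List.Lex.rel h)
    · rcases (htmin t' hq).lt_or_eq with h | rfl
      · exact le_of_lt (List.Lex.cons h)
      · exact le_rfl

section RootSystem

variable [Finite ι] [P.IsRootSystem] [P.IsCrystallographic] [P.IsReduced]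

lemma isReducedExpression_sortingWord (b : P.Base) (c : List b.support)
    (hc : ∀ s : b.support, s ∈ c) :
    IsReducedExpression b (sortingWord b c) (longestElement b) := by
  have hne : {p | SpellsLongest b c p}.Nonempty := by
    obtain ⟨u, hu⟩ := exists_isReducedExpression b (longestElement b)
    have hidx : ∀ s : b.support, ∃ i : Fin c.length, c.get i = s :=
      fun s => List.mem_iff_get.1 (hc s)
    choose f hf using hidx
    refine ⟨(List.finRange u.length).map fun k : Fin u.length =>
      (toLex ((k : ℕ), f (u.get k)) : ℕ ×ₗ Fin c.length), ?_, ?_⟩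
    · rw [List.pairwise_map]
      refine (List.pairwise_lt_finRange _).imp fun {k l} hkl => ?_
      exact Prod.Lex.toLex_lt_toLex.2 (Or.inl hkl)
    · rw [List.map_map]
      have : ((fun x : ℕ ×ₗ Fin c.length => c.get (ofLex x).2) ∘
          fun k : Fin u.length => (toLex ((k : ℕ), f (u.get k)) : ℕ ×ₗ Fin c.length)) = u.get :=
        funext fun k => hf _
      rw [this, List.map_get_finRange]
      exact hu
  obtain ⟨p, hp, hmin⟩ := exists_le_of_forall_length_eq (coxeterLength b (longestElement b))
    {p | SpellsLongest b c p} hne fun p hp => by rw [← hp.2.2, List.length_map]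
  have hex : ∃ p, IsFirstSpelling b c p := ⟨p, hp, hmin⟩
  rw [sortingWord, dif_pos hex]
  exact hex.choose_spec.1.2

lemma coord_wordProd_smul_of_notMem (b : P.Base) {s : b.support} (w : List b.support)
    (h : s ∉ w) (v : V) : coord b s (wordProd b w • v) = coord b s v := by
  induction w with
  | nil => simp
  | cons t w ih =>
    rw [List.mem_cons, not_or] at h
    rw [wordProd_cons, mul_smul, coord_simpleReflection_smul_of_ne b (Ne.symm h.1), ih h.2]

/-- A reduced expression of a Coxeter element contains every simple reflection exactly once: if `s`
were missing, the Coxeter element would fix the coordinate form of `s`, and so would `s`. -/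
lemma IsCoxeterWord.isOrdering {b : P.Base} {c : List b.support} (h : IsCoxeterWord b c) :
    IsOrdering b c := by
  classical
  obtain ⟨g, ⟨w, ⟨hnodup, hall⟩, hw⟩, hc, hlen⟩ := h
  have hmem : ∀ s, s ∈ c := by
    intro s
    by_contra hs
    obtain ⟨w₁, w₂, rfl⟩ := List.append_of_mem (hall s)
    rw [List.nodup_append] at hnodup
    obtain ⟨-, h2, h3⟩ := hnodup
    have hs1 : s ∉ w₁ := fun hh => h3 s hh s (by simp) rfl
    have hs2 : s ∉ w₂ := (List.nodup_cons.1 h2).1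
    have key : ∀ v : V, coord b s (simpleReflection b s • v) = coord b s v := by
      intro v
      have h4 := coord_wordProd_smul_of_notMem b c hs ((wordProd b w₂)⁻¹ • v)
      rw [hc, ← hw, wordProd_append, wordProd_cons, mul_smul, mul_smul, smul_inv_smul,
        coord_wordProd_smul_of_notMem b _ hs1] at h4
      rw [h4, ← wordProd_reverse, coord_wordProd_smul_of_notMem b _ (by simpa using hs2)]
    have h5 := key (P.root s)
    rw [simpleReflection_smul_self, map_neg, coord_root_self] at h5
    norm_num at h5
  refine ⟨?_, hmem⟩
  have h1 : c.length ≤ w.length := by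
    rw [hlen, ← hw]
    exact coxeterLength_le b w
  have h2 : c.toFinset = w.toFinset := by
    ext s
    simp [hmem s, hall s]
  rw [← List.dedup_eq_self]
  refine (List.dedup_sublist c).eq_of_length_le ?_
  rwa [← List.card_toFinset, h2, List.toFinset_card_of_nodup hnodup]

/-! ### The bi-infinite sequence attached to a word -/

/-- The power `η ^ k` of the opposition involution. -/
def twist (b : P.Base) (k : ℤ) (s : b.support) : b.support :=
  if Even k then s else opposition b s

lemma twist_add_one (b : P.Base) (k : ℤ) (s : b.support) :
    twist b (k + 1) s = opposition b (twist b k s) := by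
  by_cases hk : Even k
  · rw [twist, if_neg (by rw [Int.even_add_one]; simpa using hk), twist, if_pos hk]
  · rw [twist, if_pos (Int.even_add_one.2 hk), twist, if_neg hk, opposition_opposition]

lemma twist_zero (b : P.Base) (s : b.support) : twist b 0 s = s := by simp [twist]

/-- The sequence of letters of `⋯ Q η(Q) Q η(Q) ⋯`, indexed by the integers. -/
def periodicWord (b : P.Base) (Q : List b.support) (hm : 0 < Q.length) (z : ℤ) : b.support :=
  twist b (z / Q.length) (Q.get ⟨(z % Q.length).toNat, by
    have := Int.emod_lt_of_pos z (Int.natCast_pos.2 hm)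
    have := Int.emod_nonneg z (by omega : (Q.length : ℤ) ≠ 0)
    omega⟩)

variable {b : P.Base} {Q : List b.support} (hm : 0 < Q.length)

lemma periodicWord_mul_add (k : ℤ) (i : Fin Q.length) :
    periodicWord b Q hm (k * Q.length + i) = twist b k (Q.get i) := by
  have h1 : (k * Q.length + i) / (Q.length : ℤ) = k := by
    rw [add_comm, Int.add_mul_ediv_right _ _ (by omega), Int.ediv_eq_zero_of_lt (by omega)
      (by omega), zero_add]
  have h2 : (k * Q.length + i) % (Q.length : ℤ) = i := by
    rw [add_comm, Int.add_mul_emod_self_right, Int.emod_eq_of_lt (by omega) (by omega)]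
  simp only [periodicWord, h1, h2, Int.toNat_natCast]

lemma exists_eq_mul_add {n : ℕ} (hn : 0 < n) (z : ℤ) :
    ∃ (k : ℤ) (i : Fin n), z = k * n + i := by
  have h1 := Int.emod_lt_of_pos z (Int.natCast_pos.2 hn)
  have h2 := Int.emod_nonneg z (by omega : (n : ℤ) ≠ 0)
  refine ⟨z / n, ⟨(z % n).toNat, by omega⟩, ?_⟩
  have h3 := Int.mul_ediv_add_emod z n
  rw [mul_comm] at h3
  simp only
  omega

lemma periodicWord_natCast (i : Fin Q.length) : periodicWord b Q hm (i : ℕ) = Q.get i := by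
  have := periodicWord_mul_add hm 0 i
  rwa [zero_mul, zero_add, twist_zero] at this

lemma periodicWord_add_length (z : ℤ) :
    periodicWord b Q hm (z + Q.length) = opposition b (periodicWord b Q hm z) := by
  obtain ⟨k, i, rfl⟩ := exists_eq_mul_add hm z
  rw [periodicWord_mul_add, ← twist_add_one, ← periodicWord_mul_add hm]
  congr 1
  ring

/-- In `Q_c` the first occurrences of the letters form the initial copy of `c`; what remains is the
sorting word of the longest element. -/
lemma isReducedSubword_wordQ {c : List b.support} (hc : IsOrdering b c)
    (hm : 0 < (wordQ b c).length) :
    IsReducedSubword b (fun l : ℕ => periodicWord b (wordQ b c) hm l) (wordQ b c).length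
      (laterPositions fun l : ℕ => periodicWord b (wordQ b c) hm l) (longestElement b) := by
  set q : ℕ → b.support := fun l : ℕ => periodicWord b (wordQ b c) hm l with hqdef
  have hlen : (wordQ b c).length = c.length + (sortingWord b c).length := List.length_append
  have hq : ∀ (k : ℕ) (hk : k < (wordQ b c).length), q k = (wordQ b c)[k] := fun k hk =>
    periodicWord_natCast hm ⟨k, hk⟩
  have hqc : ∀ (k : ℕ) (hk : k < c.length), q k = c.get ⟨k, hk⟩ := by
    intro k hk
    rw [hq k (by omega)]
    exact List.getElem_append_left hk
  have hqv : ∀ (k : ℕ) (hk : k < (sortingWord b c).length),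
      q (c.length + k) = (sortingWord b c)[k] := by
    intro k hk
    rw [hq _ (by omega)]
    simp [wordQ]
  have hfirst : ∀ k < c.length, k ∉ laterPositions q := by
    rintro k hk ⟨l, hl, hlk⟩
    rw [hqc k hk, hqc l (by omega)] at hlk
    have := (List.Nodup.getElem_inj_iff hc.1).1 hlk
    omega
  have hlater : ∀ k < (sortingWord b c).length, k ∈ {l | c.length + l ∈ laterPositions q} := by
    intro k hk
    obtain ⟨i, hi, hik⟩ := List.getElem_of_mem (hc.2 (q (c.length + k)))
    exact ⟨i, by omega, (hqc i hi).trans hik⟩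
  obtain ⟨h1, h2⟩ := partialProd_eq_wordProd b (sortingWord b c) (fun l => q (c.length + l)) _
    hlater hqv
  obtain ⟨h3, h4⟩ := isReducedExpression_sortingWord b c hc.2
  refine ⟨?_, ?_⟩
  · rw [hlen, partialProd_add, partialProd_of_forall_notMem b q hfirst, one_mul, h1, h3]
  · rw [hlen, usedCount_add, usedCount_of_forall_notMem hfirst, zero_add, h2, h4]

/-! ### Clusters as sets of unused positions -/

lemma subword_eq_map_filter {B : Type*} (Q : List B) (X : Finset (Fin Q.length)) :
    subword Q X = ((List.finRange Q.length).filter (· ∈ X)).map Q.get := by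
  rw [subword]
  congr 1
  refine List.Perm.eq_of_pairwise (le := (· ≤ ·)) (fun a b _ _ => le_antisymm)
    (Finset.pairwise_sort X _)
    (((List.pairwise_lt_finRange _).imp fun h => h.le).filter _) ?_
  rw [List.perm_ext_iff_of_nodup (Finset.sort_nodup X _) ((List.nodup_finRange _).filter _)]
  simp

lemma wordProd_map_filter (b : P.Base) (n : ℕ) (f : Fin n → b.support) (X : Fin n → Bool)
    (q : ℕ → b.support) (M : Set ℕ) (hq : ∀ i : Fin n, q i = f i)
    (hM : ∀ i : Fin n, (i : ℕ) ∈ M ↔ X i = true) :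
    wordProd b (((List.finRange n).filter X).map f) = partialProd b q M n ∧
      (((List.finRange n).filter X).map f).length = usedCount M n := by
  induction n with
  | zero => simp
  | succ n ih =>
    obtain ⟨h1, h2⟩ := ih (f ∘ Fin.castSucc) (X ∘ Fin.castSucc) (fun i => hq i.castSucc)
      (fun i => hM i.castSucc)
    have hlast := hM (Fin.last n)
    have hqlast := hq (Fin.last n)
    rw [Fin.val_last] at hlast hqlast
    rw [List.finRange_succ_last, List.filter_append, List.map_append, List.filter_map,
      List.map_map, wordProd_append, List.length_append, h1, h2, partialProd_succ, usedCount_succ]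
    by_cases hX : X (Fin.last n) = true
    · rw [factor_of_mem b (hlast.2 hX), if_pos (hlast.2 hX), List.filter_cons_of_pos hX, hqlast]
      simp
    · have hn : n ∉ M := fun hh => hX (hlast.1 hh)
      rw [factor_of_notMem b hn, if_neg hn, List.filter_cons_of_neg hX]
      simp

/-- The complement of a set of positions of a word of length `n`, repeated with period `n`. -/
def usedPositions {n : ℕ} (hm : 0 < n) (I : Finset (Fin n)) : Set ℕ :=
  {k | (⟨k % n, Nat.mod_lt _ hm⟩ : Fin n) ∉ I}

lemma mem_usedPositions_fin {n : ℕ} (hm : 0 < n) (I : Finset (Fin n)) (i : Fin n) :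
    (i : ℕ) ∈ usedPositions hm I ↔ i ∉ I := by
  have : (⟨(i : ℕ) % n, Nat.mod_lt _ hm⟩ : Fin n) = i := Fin.ext (Nat.mod_eq_of_lt i.2)
  rw [usedPositions, Set.mem_ofPred_eq, this]

lemma mem_usedPositions_add {n : ℕ} (hm : 0 < n) (I : Finset (Fin n)) (k : ℕ) :
    k + n ∈ usedPositions hm I ↔ k ∈ usedPositions hm I := by
  simp only [usedPositions, Set.mem_ofPred_eq, Nat.add_mod_right]

lemma isCluster_iff (I : Finset (Fin Q.length)) :
    IsCluster b Q I ↔ IsReducedSubword b (fun l : ℕ => periodicWord b Q hm l) Q.length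
      (usedPositions hm I) (longestElement b) := by
  obtain ⟨h1, h2⟩ := wordProd_map_filter b Q.length Q.get (fun i => decide (i ∈ Iᶜ))
    (fun l : ℕ => periodicWord b Q hm l) (usedPositions hm I) (periodicWord_natCast hm)
    (fun i => by rw [mem_usedPositions_fin]; simp)
  rw [IsCluster, IsReducedExpression, IsReducedSubword, subword_eq_map_filter, h1, h2]

lemma rootFunction_eq (I : Finset (Fin Q.length)) (j : Fin Q.length) :
    rootFunction b Q I j =
      rootAt b (fun l : ℕ => periodicWord b Q hm l) (usedPositions hm I) j := by
  obtain ⟨h1, -⟩ := wordProd_map_filter b Q.length Q.get (fun i => decide (i ∈ Finset.Iio j \ I))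
    (fun l : ℕ => periodicWord b Q hm l) (usedPositions hm I ∩ Set.Iio (j : ℕ))
    (periodicWord_natCast hm)
    (fun i => by
      rw [Set.mem_inter_iff, mem_usedPositions_fin, decide_eq_true_iff, Finset.mem_sdiff,
        Finset.mem_Iio, Set.mem_Iio, and_comm]
      rfl)
  have h2 : partialProd b (fun l : ℕ => periodicWord b Q hm l)
      (usedPositions hm I ∩ Set.Iio (j : ℕ)) Q.length =
      partialProd b (fun l : ℕ => periodicWord b Q hm l) (usedPositions hm I) j := by
    obtain ⟨n, hn⟩ : ∃ n, Q.length = j + n := ⟨Q.length - j, by omega⟩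
    generalize usedPositions hm I = M
    rw [congrArg (partialProd b _ _) hn, partialProd_add,
      partialProd_of_forall_notMem b (M := {l | (j : ℕ) + l ∈ _}) _
      (fun k _ => by simp), mul_one]
    exact partialProd_congr b (fun _ _ => rfl) fun k hk => by simp [hk]
  rw [rootFunction, subword_eq_map_filter, h1, h2, rootAt, periodicWord_natCast]

end RootSystem

end

section

variable {ι V V' : Type*} [AddCommGroup V] [Module ℝ V] [AddCommGroup V'] [Module ℝ V']
  {P : RootPairing ι ℝ V V'} [Finite ι] [P.IsRootSystem] [P.IsCrystallographic] [P.IsReduced]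
  {b : P.Base} {Q : List b.support}

/-! ### The coefficients as values of the mesh function -/

/-- The position of `j` in the cyclic rotation of the word that begins at `i`. -/
def cyclicIndex {n : ℕ} (i j : Fin n) : ℕ := if i ≤ j then j - i else j + n - i

lemma cyclicIndex_lt {n : ℕ} (i j : Fin n) : cyclicIndex i j < n := by
  rw [cyclicIndex]
  split_ifs with h
  · omega
  · have : (j : ℕ) < i := not_le.1 h
    omega

lemma cyclicIndex_pos {n : ℕ} {i j : Fin n} (h : j ≠ i) : 0 < cyclicIndex i j := by
  rw [cyclicIndex]
  have : (j : ℕ) ≠ i := fun hh => h (Fin.ext hh)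
  split_ifs with h
  · have : (i : ℕ) ≤ j := h
    omega
  · omega

lemma mem_usedPositions_cyclicIndex {n : ℕ} (hm : 0 < n) (I : Finset (Fin n)) (i j : Fin n) :
    (i : ℕ) + cyclicIndex i j ∈ usedPositions hm I ↔ j ∉ I := by
  rw [cyclicIndex]
  split_ifs with h
  · have : (i : ℕ) ≤ j := h
    rw [Nat.add_sub_cancel' this, mem_usedPositions_fin]
  · rw [Nat.add_sub_cancel' (by omega), mem_usedPositions_add, mem_usedPositions_fin]

lemma exists_cyclicIndex_eq {n : ℕ} (i : Fin n) {k : ℕ} (hk : k < n) :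
    ∃ j : Fin n, cyclicIndex i j = k := by
  by_cases h : (i : ℕ) + k < n
  · exact ⟨⟨i + k, h⟩, by rw [cyclicIndex, if_pos (Fin.le_def.2 (by simp))]; simp⟩
  · refine ⟨⟨i + k - n, by omega⟩, ?_⟩
    rw [cyclicIndex, if_neg (fun hh => by have := Fin.le_def.1 hh; simp only at this; omega)]
    simp only
    omega

/-- The sign by which the root function changes when the word is rotated so as to begin at `i`. -/
def rotationSign {n : ℕ} (i j : Fin n) : ℝ := if i ≤ j then 1 else -1

lemma rotationSign_mul_self {n : ℕ} (i j : Fin n) : rotationSign i j * rotationSign i j = 1 := by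
  rw [rotationSign]
  split_ifs <;> norm_num

lemma rootFunction_eq_rotate (hm : 0 < Q.length) {I : Finset (Fin Q.length)}
    (hI : IsCluster b Q I) (i j : Fin Q.length) :
    rootFunction b Q I j = rotationSign i j •
      (partialProd b (fun l : ℕ => periodicWord b Q hm l) (usedPositions hm I) i •
        rootAt b (fun l : ℕ => periodicWord b Q hm (i + l : ℕ)) {l | i + l ∈ usedPositions hm I}
          (cyclicIndex i j)) := by
  have hper : ∀ k : ℕ, periodicWord b Q hm (k + Q.length : ℕ) =
      opposition b (periodicWord b Q hm k) := fun k => by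
    rw [Nat.cast_add]
    exact periodicWord_add_length hm k
  rw [rootFunction_eq hm,
    rootAt_rotate b (q := fun l : ℕ => periodicWord b Q hm l) (M := usedPositions hm I) i,
    smul_inv_smul, rotationSign, cyclicIndex]
  split_ifs with h
  · have : (i : ℕ) ≤ j := h
    rw [Nat.add_sub_cancel' this, one_smul]
  · rw [Nat.add_sub_cancel' (by omega), rootAt_add_period b hper (mem_usedPositions_add hm I)
      ((isCluster_iff hm I).1 hI).1, neg_smul, one_smul, neg_neg]

section

variable {p : ℤ → b.support} {m : ℕ}

lemma Interlaced.shift (hint : Interlaced p) (x : ℤ) : Interlaced fun z => p (x + z) := by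
  intro z₁ z₂ hz hzq s hs hps
  obtain ⟨z, h1, h2, h3⟩ := hint (add_lt_add_right hz x) hzq s hs hps
  obtain ⟨y, rfl⟩ : ∃ y, z = x + y := ⟨z - x, by omega⟩
  exact ⟨y, by omega, by omega, h3⟩

lemma isReducedSubword_laterPositions_shift (hint : Interlaced p)
    (hper : ∀ z, p (z + m) = opposition b (p z))
    (h : IsReducedSubword b (fun l : ℕ => p l) m (laterPositions fun l : ℕ => p l)
      (longestElement b)) (i : ℕ) :
    IsReducedSubword b (fun l : ℕ => p (i + l)) m (laterPositions fun l : ℕ => p (i + l))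
      (longestElement b) := by
  have h1 := isReducedSubword_laterPositions b (hint.natCast b)
    (fun k => by rw [Nat.cast_add]; exact hper k) h i
  simpa only [Nat.cast_add] using h1

/-- All reduced subwords avoiding the first position give the same values of the coordinate form of
the first letter on the root function, and this form vanishes at the other unused positions. -/
lemma coord_rootAt_eq_sliceRoot (hint : Interlaced p)
    (h : IsReducedSubword b (fun l : ℕ => p l) m (laterPositions fun l : ℕ => p l)
      (longestElement b)) {M : Set ℕ}
    (hM : IsReducedSubword b (fun l : ℕ => p l) m M (longestElement b)) (h0 : 0 ∉ M) :
    (∀ k < m, 0 < k → k ∉ M → coord b (p 0) (rootAt b (fun l : ℕ => p l) M k) = 0) ∧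
      ∀ k < m, coord b (p 0) (rootAt b (fun l : ℕ => p l) M k) =
        coord b (p 0) (sliceRoot b p m k) := by
  cases m with
  | zero => simp
  | succ m =>
    set q : ℕ → b.support := fun l : ℕ => p l with hq
    set K := laterPositions q ∩ Set.Iio (m + 1) with hK
    have hK0 : 0 ∉ K := fun ⟨⟨l, hl, _⟩, _⟩ => by omega
    have hroot : ∀ {N : Set ℕ} (k : ℕ), 0 ∉ N →
        rootAt b q N (k + 1) = rootAt b (fun l => q (l + 1)) {l | l + 1 ∈ N} k := by
      intro N k hN
      rw [rootAt_succ, factor_of_notMem b hN, one_smul]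
    obtain ⟨h1, h2⟩ := IsReducedSubword.apply_rootAt_eq b (fun l => q (l + 1))
      (coord b (p 0)) ((h.inter_Iio b).succ_of_notMem b hK0) (hM.succ_of_notMem b h0)
      (fun k hk hkK => by
        have hkq : k + 1 ∉ laterPositions q := fun hh => hkK ⟨hh, by simp; omega⟩
        rw [← hroot k hK0]
        change coord b (p 0) (sliceRoot b p (m + 1) (k + 1)) = 0
        rw [sliceRoot_of_notMem b hint hkq]
        exact coord_root_of_ne b fun hh => hkq ⟨0, by omega, by simp only [hq]; exact hh.symm⟩)
    refine ⟨fun k hk hk0 hkM => ?_, fun k hk => ?_⟩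
    · obtain ⟨k, rfl⟩ : ∃ l, k = l + 1 := ⟨k - 1, by omega⟩
      rw [hroot k h0]
      exact h1 k (by omega) hkM
    · cases k with
      | zero => rw [sliceRoot, rootAt_zero, rootAt_zero]
      | succ k =>
        rw [hroot k h0, h2 k (by omega), ← hroot k hK0]
        rfl

end

/-- The coefficient `{i ‖ j}` exists, is unique, and is the value of the mesh function of the word
rotated so as to begin at `i`. -/
theorem isCompatibilityDegree_iff (hm : 0 < Q.length) (hint : Interlaced (periodicWord b Q hm))
    (h : IsReducedSubword b (fun l : ℕ => periodicWord b Q hm l) Q.length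
      (laterPositions fun l : ℕ => periodicWord b Q hm l) (longestElement b))
    (i j : Fin Q.length) (x : ℝ) :
    IsCompatibilityDegree b Q i j x ↔
      x = meshFun b (fun z => periodicWord b Q hm (i + z)) Q.length (cyclicIndex i j) := by
  set p : ℤ → b.support := fun z => periodicWord b Q hm (i + z) with hp
  have hpq : (fun l : ℕ => p l) = fun l : ℕ => periodicWord b Q hm (i + l : ℕ) :=
    funext fun l => by rw [hp, Nat.cast_add]
  have hper : ∀ k : ℕ, periodicWord b Q hm (k + Q.length : ℕ) =
      opposition b (periodicWord b Q hm k) := fun k => by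
    rw [Nat.cast_add]
    exact periodicWord_add_length hm k
  have hpint : Interlaced p := hint.shift i
  have hslice : IsReducedSubword b (fun l : ℕ => p l) Q.length
      (laterPositions fun l : ℕ => p l) (longestElement b) :=
    isReducedSubword_laterPositions_shift hint (periodicWord_add_length hm) h i
  have hrot : ∀ I : Finset (Fin Q.length), IsReducedSubword b (fun l : ℕ => p l) Q.length
      {l | (i : ℕ) + l ∈ usedPositions hm I} (longestElement b) ↔ IsCluster b Q I := by
    intro I
    rw [isCluster_iff hm, hpq]
    exact isReducedSubword_rotate_iff b (q := fun l : ℕ => periodicWord b Q hm l) hper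
      (mem_usedPositions_add hm I) i
  have hrank : ∀ I : Finset (Fin Q.length), IsCluster b Q I → ∀ j, rootFunction b Q I j =
      rotationSign i j • (partialProd b (fun l : ℕ => periodicWord b Q hm l)
        (usedPositions hm I) i • rootAt b (fun l : ℕ => p l)
          {l | (i : ℕ) + l ∈ usedPositions hm I} (cyclicIndex i j)) := by
    intro I hI j
    rw [hpq]
    exact rootFunction_eq_rotate hm hI i j
  have hii : cyclicIndex i i = 0 := by simp [cyclicIndex]
  have hunique : ∀ y, IsCompatibilityDegree b Q i j y →
      y = meshFun b p Q.length (cyclicIndex i j) := by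
    rintro y ⟨I, hI, hiI, ρ, hρ, rfl⟩
    have h0 : 0 ∉ {l | (i : ℕ) + l ∈ usedPositions hm I} := by
      have := mem_usedPositions_cyclicIndex hm I i i
      rw [hii] at this
      rw [Set.mem_ofPred_eq, this, not_not]
      exact hiI
    obtain ⟨hvan, hval⟩ := coord_rootAt_eq_sliceRoot hpint hslice ((hrot I).2 hI) h0
    -- The linear form that reads off the coefficient of `r(I, i)`.
    set G := partialProd b (fun l : ℕ => periodicWord b Q hm l) (usedPositions hm I) i with hG
    have hform : ∀ k, coord b (p 0) (G⁻¹ • rootFunction b Q I k) =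
        rotationSign i k * coord b (p 0) (sliceRoot b p Q.length (cyclicIndex i k)) := by
      intro k
      rw [hrank I hI k, ← hG, weylGroup_smul_smul, inv_smul_smul, map_smul, smul_eq_mul,
        hval _ (cyclicIndex_lt i k)]
    have hρi : rotationSign i j * coord b (p 0) (sliceRoot b p Q.length (cyclicIndex i j)) =
        ρ i := by
      rw [← hform, hρ]
      change coord b (p 0) (actionMap G⁻¹ _) = _
      rw [map_sum, map_sum, Finset.sum_eq_single_of_mem i hiI]
      · rw [map_smul, map_smul, actionMap_apply, hform, hii, sliceRoot, rootAt_zero]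
        simp [rotationSign, coord_root_self]
      · intro k hk hki
        rw [map_smul, map_smul, actionMap_apply, hform, ← hval _ (cyclicIndex_lt i k),
          hvan _ (cyclicIndex_lt i k) (cyclicIndex_pos hki)
            (fun hh => (mem_usedPositions_cyclicIndex hm I i k).1 hh hk)]
        simp
    rcases eq_or_ne j i with rfl | hji
    · rw [if_neg (lt_irrefl _), ← hρi, hii, Nat.cast_zero, meshFun_zero, sliceRoot, rootAt_zero]
      simp [rotationSign, coord_root_self]
    · rw [meshFun_natCast b p _ (cyclicIndex_pos hji) (cyclicIndex_lt i j).le, ← hρi, rotationSign]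
      by_cases hij : i ≤ j
      · rw [if_pos (lt_of_le_of_ne hij hji.symm), if_pos hij, one_mul]
      · rw [if_neg (fun hh => hij hh.le), if_neg hij, neg_mul, one_mul, neg_neg]
  refine ⟨hunique x, ?_⟩
  -- The cluster of first occurrences, in the word that begins at `i`.
  suffices hex : ∃ y, IsCompatibilityDegree b Q i j y by
    rintro rfl
    obtain ⟨y, hy⟩ := hex
    rwa [← hunique y hy]
  classical
  set K := laterPositions (fun l : ℕ => p l) with hK
  set I : Finset (Fin Q.length) := Finset.univ.filter fun k => cyclicIndex i k ∉ K with hIdef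
  have hMK : ∀ k < Q.length, k ∈ {l | (i : ℕ) + l ∈ usedPositions hm I} ↔ k ∈ K := by
    intro k hk
    obtain ⟨l, rfl⟩ := exists_cyclicIndex_eq i hk
    rw [Set.mem_ofPred_eq, mem_usedPositions_cyclicIndex]
    simp [hIdef]
  have hI : IsCluster b Q I := by
    rw [← hrot I]
    refine ⟨?_, ?_⟩
    · rw [← hslice.1]
      exact partialProd_congr b (fun _ _ => rfl) hMK
    · rw [← hslice.2, usedCount, usedCount, Nat.count_eq_card_filter_range,
        Nat.count_eq_card_filter_range]
      exact congrArg Finset.card (Finset.filter_congr fun k hk => hMK k (Finset.mem_range.1 hk))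
  have hiI : i ∈ I := by
    rw [hIdef, Finset.mem_filter, hii]
    exact ⟨Finset.mem_univ _, fun ⟨l, hl, _⟩ => by omega⟩
  set G := partialProd b (fun l : ℕ => periodicWord b Q hm l) (usedPositions hm I) i with hG
  set U := Submodule.span ℝ (rootFunction b Q I '' I) with hU
  have hsimple : ∀ s : b.support, G • P.root s ∈ U := by
    intro s
    have hex : ∃ k : ℕ, p k = s := by
      obtain ⟨k, -, -, hk⟩ := exists_mem_eq_of_longestElement b hslice.1 s
      exact ⟨k, hk⟩
    have hfirst : Nat.find hex ∉ K := fun ⟨l, hl, hlk⟩ =>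
      Nat.find_min hex hl (hlk.trans (Nat.find_spec hex))
    have hlt : Nat.find hex < Q.length := by
      obtain ⟨k, hk, -, hks⟩ := exists_mem_eq_of_longestElement b hslice.1 s
      exact (Nat.find_min' hex hks).trans_lt hk
    obtain ⟨l, hl⟩ := exists_cyclicIndex_eq i hlt
    have hlI : l ∈ I := by
      rw [hIdef, Finset.mem_filter, hl]
      exact ⟨Finset.mem_univ _, hfirst⟩
    have hroot : rootAt b (fun l : ℕ => p l) {l | (i : ℕ) + l ∈ usedPositions hm I}
        (cyclicIndex i l) = P.root s := by
      rw [rootAt, partialProd_congr b (M' := K) (fun _ _ => rfl)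
        fun k hk => hMK k (hk.trans (cyclicIndex_lt i l))]
      have := rootAt_laterPositions b (hpint.natCast b) hfirst subset_rfl
      rw [hl, ← rootAt, this, Nat.find_spec hex]
    have hmem : rotationSign i l • rootFunction b Q I l ∈ U :=
      U.smul_mem _ (Submodule.subset_span ⟨l, hlI, rfl⟩)
    rwa [hrank I hI l, hroot, smul_smul, rotationSign_mul_self, one_smul] at hmem
  have htop : ∀ v : V, v ∈ U := by
    intro v
    rw [← smul_inv_smul G v, ← b.toWeightBasis.sum_repr (G⁻¹ • v)]
    change actionMap G _ ∈ U
    rw [map_sum]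
    refine U.sum_mem fun s _ => ?_
    rw [map_smul, RootPairing.Base.toWeightBasis_apply]
    exact U.smul_mem _ (hsimple s)
  obtain ⟨ρ, hρ⟩ := (Submodule.mem_span_image_finset_iff_exists_fun' ℝ).1
    (htop (rootFunction b Q I j))
  exact ⟨_, I, hI, hiI, ρ, hρ.symm, rfl⟩

end

section

variable {ι V V' : Type*} [AddCommGroup V] [Module ℝ V] [AddCommGroup V'] [Module ℝ V']
  {P : RootPairing ι ℝ V V'} [Finite ι] [P.IsRootSystem] [P.IsCrystallographic] [P.IsReduced]
  {b : P.Base}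

/-! ### Comparison of the coefficients of two periodic words -/

lemma twist_injective (k : ℤ) : Function.Injective (twist b k) := by
  unfold twist
  split_ifs
  · exact fun _ _ h => h
  · exact opposition_injective b

lemma pairing_twist (k : ℤ) (s t : b.support) :
    P.pairing (twist b k s) (twist b k t) = P.pairing s t := by
  unfold twist
  split_ifs
  · rfl
  · exact pairing_opposition b s t

lemma apply_add_mul_period {p : ℤ → b.support} {m : ℕ}
    (hper : ∀ z, p (z + m) = opposition b (p z)) (z k : ℤ) :
    p (z + k * m) = twist b k (p z) := by
  induction k using Int.induction_on with
  | zero => simp [twist_zero]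
  | succ k ih => rw [add_mul, one_mul, ← add_assoc, hper, ih, twist_add_one]
  | pred k ih =>
    have h1 := hper (z + (-k - 1) * m)
    have h2 : z + (-k - 1) * m + m = z + -k * (m : ℤ) := by ring
    have h3 := twist_add_one b (-k - 1) (p z)
    rw [sub_add_cancel] at h3
    rw [h2, ih, h3] at h1
    exact (opposition_injective b h1).symm

lemma exists_lt_eq_of_period {p : ℤ → b.support} {m : ℕ} (hm : 0 < m)
    (hper : ∀ z, p (z + m) = opposition b (p z)) (z N : ℤ) : ∃ y < N, p y = p z := by
  refine ⟨z + (-2 * (|z - N| + 1)) * m, ?_, ?_⟩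
  · have h1 := le_abs_self (z - N)
    have h2 : (1 : ℤ) ≤ m := by exact_mod_cast hm
    nlinarith [abs_nonneg (z - N)]
  · rw [apply_add_mul_period hper, twist, if_pos]
    exact ⟨-(|z - N| + 1), by ring⟩

lemma exists_gt_eq_of_period {p : ℤ → b.support} {m : ℕ} (hm : 0 < m)
    (hper : ∀ z, p (z + m) = opposition b (p z)) (z N : ℤ) : ∃ y > N, p y = p z := by
  refine ⟨z + (2 * (|z - N| + 1)) * m, ?_, ?_⟩
  · have h1 := neg_abs_le (z - N)
    have h2 : (1 : ℤ) ≤ m := by exact_mod_cast hm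
    nlinarith [abs_nonneg (z - N)]
  · rw [apply_add_mul_period hper, twist, if_pos]
    exact ⟨|z - N| + 1, by ring⟩

/-- The mesh functions of two windows agree at corresponding positions, provided that the bijection
of positions matches the ends of the windows. The mesh relations are used both from left to right
and from right to left: two positions of one orbit that lie in the respective windows need not
correspond to each other, and then both values are zero. -/
lemma meshFun_eq_of_equiv {p p' : ℤ → b.support} {m m' : ℕ} (hm : 0 < m) (hm' : 0 < m')
    (hint : Interlaced p) (hint' : Interlaced p')
    (hper : ∀ z, p (z + m) = opposition b (p z)) (hper' : ∀ z, p' (z + m') = opposition b (p' z))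
    (h : IsReducedSubword b (fun l : ℕ => p l) m (laterPositions fun l : ℕ => p l)
      (longestElement b))
    (h' : IsReducedSubword b (fun l : ℕ => p' l) m' (laterPositions fun l : ℕ => p' l)
      (longestElement b))
    (E : ℤ ≃ ℤ) (hE0 : E 0 = 0) (hEm : E m = m')
    (hletter : ∀ y z, p y = p z ↔ p' (E y) = p' (E z))
    (ha : ∀ y z, P.pairing (p y) (p z) = P.pairing (p' (E y)) (p' (E z)))
    (hlt : ∀ y z, (p y = p z ∨ P.pairing (p y) (p z) ≠ 0) → (y < z ↔ E y < E z))
    {Y Z : ℕ} (hY : Y < m) (hZ : Z < m') {r : ℤ} (hYZ : E Y = Z + r * m')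
    (hshift : E (Y - r * m) = Z) : meshFun b p m Y = meshFun b p' m' Z := by
  have hD := isMeshSolution_meshFun b hint hper h
  have hD' := isMeshSolution_meshFun b hint' hper' h'
  have forward : ∀ y : ℤ, y < m → E y < m' → meshFun b p m y = meshFun b p' m' (E y) :=
    hD.eq_of_equiv hD' (fun z hz => meshFun_of_neg b p m hz)
      (fun z hz => meshFun_of_neg b p' m' hz) E hE0 (by rw [meshFun_zero, meshFun_zero]) hletter
      (fun y z => by rw [ha]) (fun y z hyz => hlt y z (by simpa using hyz))
      (exists_lt_eq_of_period hm hper) (exists_lt_eq_of_period hm' hper')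
  have backward : ∀ y : ℤ, 0 < y → 0 < E y → meshFun b p m y = meshFun b p' m' (E y) := by
    let E' : ℤ ≃ ℤ := ((Equiv.subLeft (m : ℤ)).trans E).trans (Equiv.subLeft (m' : ℤ))
    have hE' : ∀ y, E' y = m' - E (m - y) := fun y => rfl
    have := hD.reverse.eq_of_equiv hD'.reverse
      (fun z hz => meshFun_of_gt b p m (by omega))
      (fun z hz => meshFun_of_gt b p' m' (by omega)) E' (by rw [hE', sub_zero, hEm, sub_self])
      (by rw [sub_zero, sub_zero, meshFun_period b hper hm h, meshFun_period b hper' hm' h'])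
      (fun y z => by rw [hE', hE', sub_sub_cancel, sub_sub_cancel]; exact hletter _ _)
      (fun y z => by rw [hE', hE', sub_sub_cancel, sub_sub_cancel, ha])
      (fun y z hyz => by
        have h1 := hlt (m - z) (m - y) (by
          rcases hyz with hyz | hyz
          · exact Or.inl hyz.symm
          · exact Or.inr fun h0 => hyz (by simp only [pairing_eq_zero_symm h0, neg_zero]))
        rw [hE', hE']
        omega)
      (fun z N => by
        obtain ⟨y, hy, hyz⟩ := exists_gt_eq_of_period hm hper (m - z) (m - N)
        exact ⟨m - y, by omega, by simpa using hyz⟩)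
      (fun z N => by
        obtain ⟨y, hy, hyz⟩ := exists_gt_eq_of_period hm' hper' (m' - z) (m' - N)
        exact ⟨m' - y, by omega, by simpa using hyz⟩)
    intro y hy hEy
    have h1 := this (m - y) (by omega) (by rw [hE', sub_sub_cancel]; omega)
    simpa only [hE', sub_sub_cancel] using h1
  rcases lt_trichotomy r 0 with hr | rfl | hr
  · have hr1 : r * m' ≤ -m' := by nlinarith
    have hr2 : r * m ≤ -m := by nlinarith
    have hZ0 : Z ≠ 0 := by
      rintro rfl
      have := E.injective (hshift.trans (by rw [hE0, Nat.cast_zero]))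
      omega
    have hne : (Y : ℤ) - r * m ≠ m := by
      intro hh
      rw [hh, hEm] at hshift
      omega
    have h1 := forward Y (by omega) (by omega)
    rw [hYZ, meshFun_of_neg b p' m' (by omega)] at h1
    have h2 := backward (Y - r * m) (by omega) (by omega)
    rw [hshift, meshFun_of_gt b p m (by omega)] at h2
    rw [h1, h2]
  · rw [zero_mul, add_zero] at hYZ
    rw [forward Y (by omega) (by omega), hYZ]
  · have hr1 : (m' : ℤ) ≤ r * m' := by nlinarith
    have hr2 : (m : ℤ) ≤ r * m := by nlinarith
    have hY0 : Y ≠ 0 := by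
      rintro rfl
      rw [Nat.cast_zero, hE0] at hYZ
      omega
    have hne : (Z : ℤ) + r * m' ≠ m' := by
      intro hh
      have := E.injective (hYZ.trans (hh.trans hEm.symm))
      omega
    have h1 := backward Y (by omega) (by omega)
    rw [hYZ, meshFun_of_gt b p' m' (by omega)] at h1
    have h2 := forward (Y - r * m) (by omega) (by omega)
    rw [hshift, meshFun_of_neg b p m (by omega)] at h2
    rw [h1, h2]

end

section

variable {ι V V' : Type*} [AddCommGroup V] [Module ℝ V] [AddCommGroup V'] [Module ℝ V']
  {P : RootPairing ι ℝ V V'} [Finite ι] [P.IsRootSystem] [P.IsCrystallographic] [P.IsReduced]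
  {b : P.Base}

/-! ### Identifications with the word `⋯ w w w ⋯` -/

/-- A bijection between the positions of the bi-infinite sequence of letters `p` and those of
`⋯ w w w ⋯` that keeps the letters and the relative order of any two occurrences of equal or of
non-commuting letters. -/
structure IsIdentification (w : List b.support) (p : ℤ → b.support)
    (f : ℤ ≃ ℤ ×ₗ Fin w.length) : Prop where
  letter (z : ℤ) : w.get (ofLex (f z)).2 = p z
  lt_iff (y z : ℤ) (h : p y = p z ∨ P.pairing (p y) (p z) ≠ 0) : y < z ↔ f y < f z

/-- The positions of `⋯ Q η(Q) Q η(Q) ⋯` as integers. -/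
def positionEquiv {n : ℕ} (hn : 0 < n) : ℤ ≃ ℤ ×ₗ Fin n :=
  haveI : NeZero n := ⟨hn.ne'⟩
  (Int.divModEquiv n).trans toLex

lemma positionEquiv_mul_add {n : ℕ} (hn : 0 < n) (k : ℤ) (i : Fin n) :
    positionEquiv hn (k * n + i) = toLex (k, i) := by
  have : NeZero n := ⟨hn.ne'⟩
  rw [← Equiv.eq_symm_apply]
  rfl

lemma positionEquiv_lt_iff {n : ℕ} (hn : 0 < n) (y z : ℤ) :
    positionEquiv hn y < positionEquiv hn z ↔ y < z := by
  have key : ∀ y z : ℤ, positionEquiv hn y < positionEquiv hn z → y < z := by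
    intro y z h
    obtain ⟨k, i, rfl⟩ := exists_eq_mul_add hn y
    obtain ⟨l, j, rfl⟩ := exists_eq_mul_add hn z
    rw [positionEquiv_mul_add, positionEquiv_mul_add] at h
    rcases Prod.Lex.toLex_lt_toLex.1 h with h | ⟨rfl, h⟩
    · simp only at h
      have : (k + 1) * (n : ℤ) ≤ l * n := mul_le_mul_of_nonneg_right (by omega) (by omega)
      rw [add_mul, one_mul] at this
      have := i.2
      omega
    · have hij : (i : ℕ) < j := h
      change k * (n : ℤ) + i < k * n + j
      omega
  refine ⟨key y z, fun h => ?_⟩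
  by_contra hh
  rcases (not_lt.1 hh).lt_or_eq with h1 | h1
  · exact absurd h (key _ _ h1).not_gt
  · exact absurd h ((positionEquiv hn).injective h1).not_gt

lemma conj_longestElement_zpow (k : ℤ) (s : b.support) :
    (MulAut.conj (longestElement b) ^ k) (simpleReflection b s) =
      simpleReflection b (twist b k s) := by
  have hsq : MulAut.conj (longestElement b) * MulAut.conj (longestElement b) = 1 := by
    rw [← map_mul, longestElement_mul_self, map_one]
  rcases Int.even_or_odd k with ⟨r, rfl⟩ | ⟨r, rfl⟩
  · rw [← two_mul, zpow_mul, zpow_ofNat, sq, hsq, one_zpow, twist, if_pos (even_two_mul r)]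
    rfl
  · rw [zpow_add, zpow_mul, zpow_ofNat, sq, hsq, one_zpow, one_mul, zpow_one, twist,
      if_neg (by simp), simpleReflection_opposition, MulAut.conj_apply, longestElement_inv]

lemma eq_or_not_commute_iff (s t : b.support) :
    (simpleReflection b s = simpleReflection b t ∨
      ¬ Commute (simpleReflection b s) (simpleReflection b t)) ↔
      (s = t ∨ P.pairing s t ≠ 0) := by
  rw [(simpleReflection_injective b).eq_iff]
  by_cases h : s = t
  · simp [h]
  · rw [commute_iff_pairing_eq_zero b h]

lemma isIdentification_of_commutationEquiv {w c : List b.support} (hm : 0 < (wordQ b c).length)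
    (e : CommutationEquiv (tildeWordQ b c) (tildeWord b w)) :
    IsIdentification w (periodicWord b (wordQ b c) hm) ((positionEquiv hm).trans e.toEquiv) := by
  have hletter : ∀ z, tildeWordQ b c (positionEquiv hm z) =
      simpleReflection b (periodicWord b (wordQ b c) hm z) := by
    intro z
    obtain ⟨k, i, rfl⟩ := exists_eq_mul_add hm z
    rw [positionEquiv_mul_add, periodicWord_mul_add, ← conj_longestElement_zpow]
    rfl
  have hlt : ∀ y z, (periodicWord b (wordQ b c) hm y = periodicWord b (wordQ b c) hm z ∨
      P.pairing (periodicWord b (wordQ b c) hm y) (periodicWord b (wordQ b c) hm z) ≠ 0) →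
      y < z → e.toEquiv (positionEquiv hm y) < e.toEquiv (positionEquiv hm z) := by
    intro y z h hyz
    refine e.lt_of_lt _ _ ?_ ((positionEquiv_lt_iff hm y z).2 hyz)
    rwa [hletter, hletter, eq_or_not_commute_iff]
  refine ⟨fun z => ?_, fun y z h => ⟨hlt y z h, fun hyz => ?_⟩⟩
  · have h1 := e.letter_eq (positionEquiv hm z)
    rw [hletter] at h1
    exact simpleReflection_injective b h1
  · by_contra hh
    rcases (not_lt.1 hh).lt_or_eq with h1 | h1
    · refine absurd hyz (hlt z y ?_ h1).not_gt
      exact h.imp Eq.symm fun h0 h2 => h0 (pairing_eq_zero_symm h2)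
    · rw [h1] at hyz
      exact lt_irrefl _ hyz

lemma orbit_eq_range {w c : List b.support} (hm : 0 < (wordQ b c).length)
    (e : CommutationEquiv (tildeWordQ b c) (tildeWord b w)) (i : Fin (wordQ b c).length) :
    orbit b e i = Set.range fun k : ℤ =>
      ((positionEquiv hm).trans e.toEquiv) (i + k * (wordQ b c).length) := by
  refine congrArg Set.range (funext fun k => ?_)
  rw [Equiv.trans_apply, add_comm, positionEquiv_mul_add]

section

variable {w : List b.support} {p : ℤ → b.support} {f : ℤ ≃ ℤ ×ₗ Fin w.length}

lemma IsIdentification.interlaced (hf : IsIdentification w p f) (hw : IsOrdering b w) :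
    Interlaced p := by
  intro z₁ z₂ hz hzp s hs hsp
  obtain ⟨a, ha⟩ := List.mem_iff_get.1 (hw.2 s)
  have hlt := (hf.lt_iff z₁ z₂ (Or.inl hzp)).1 hz
  have h2 : (ofLex (f z₁)).2 = (ofLex (f z₂)).2 :=
    List.nodup_iff_injective_get.1 hw.1 (by rw [hf.letter, hf.letter, hzp])
  have hne : a ≠ (ofLex (f z₁)).2 := fun hh => hs (by rw [← hf.letter, ← hh, ha])
  rw [Prod.Lex.lt_iff] at hlt
  have hlt1 : (ofLex (f z₁)).1 < (ofLex (f z₂)).1 := by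
    rcases hlt with h | ⟨-, h⟩
    · exact h
    · exact absurd h (by rw [h2]; exact lt_irrefl _)
  -- The occurrence of `s` in the copy of `w` that contains `z₁`, or in the next one.
  obtain ⟨x, hx1, hx2, hxa⟩ : ∃ x : ℤ ×ₗ Fin w.length, f z₁ < x ∧ x < f z₂ ∧ (ofLex x).2 = a := by
    rcases lt_or_gt_of_ne hne with h | h
    · refine ⟨toLex ((ofLex (f z₁)).1 + 1, a), Prod.Lex.lt_iff.2 (Or.inl ?_),
        Prod.Lex.lt_iff.2 ?_, rfl⟩
      · exact Int.lt_succ _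
      · rcases (Int.add_one_le_iff.2 hlt1).lt_or_eq with h3 | h3
        · exact Or.inl h3
        · exact Or.inr ⟨h3, by rw [← h2]; exact h⟩
    · exact ⟨toLex ((ofLex (f z₁)).1, a), Prod.Lex.lt_iff.2 (Or.inr ⟨rfl, h⟩),
        Prod.Lex.lt_iff.2 (Or.inl hlt1), rfl⟩
  obtain ⟨z, rfl⟩ := f.surjective x
  have hpz : p z = s := by rw [← hf.letter, hxa, ha]
  refine ⟨z, ?_, ?_, hpz⟩
  · rw [hf.lt_iff z₁ z (Or.inr (by rw [hpz]; exact fun h0 => hsp (pairing_eq_zero_symm h0)))]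
    exact hx1
  · rw [hf.lt_iff z z₂ (Or.inr (by rw [hpz, ← hzp]; exact hsp))]
    exact hx2

/-- A strictly monotone bijection of the integers is a translation. -/
lemma eq_add_of_strictMono_of_surjective {φ : ℤ → ℤ} (hφ : StrictMono φ)
    (hs : Function.Surjective φ) (k : ℤ) : φ k = k + φ 0 := by
  have hsucc : ∀ k, φ (k + 1) = φ k + 1 := by
    intro k
    obtain ⟨j, hj⟩ := hs (φ k + 1)
    have h1 : k < j := hφ.lt_iff_lt.1 (by omega)
    have h2 : φ (k + 1) ≤ φ j := hφ.monotone (by omega)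
    have h3 : φ k < φ (k + 1) := hφ (by omega)
    omega
  induction k using Int.induction_on with
  | zero => simp
  | succ k ih => rw [hsucc, ih]; ring
  | pred k ih =>
    have := hsucc (-k - 1)
    rw [sub_add_cancel, ih] at this
    omega

/-- The position of the letter `s` in a word that lists all letters. -/
def letterIndex (hw : IsOrdering b w) (s : b.support) : Fin w.length :=
  (List.mem_iff_get.1 (hw.2 s)).choose

lemma get_letterIndex (hw : IsOrdering b w) (s : b.support) : w.get (letterIndex hw s) = s :=
  (List.mem_iff_get.1 (hw.2 s)).choose_spec

lemma letterIndex_get (hw : IsOrdering b w) (a : Fin w.length) :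
    letterIndex hw (w.get a) = a :=
  List.nodup_iff_injective_get.1 hw.1 (get_letterIndex hw _)

lemma letterIndex_injective (hw : IsOrdering b w) : Function.Injective (letterIndex hw) :=
  fun s t h => by rw [← get_letterIndex hw s, h, get_letterIndex]

/-- The occurrence of the letter `s` in the `k`-th copy of `w`. -/
def occurrence (hw : IsOrdering b w) (s : b.support) (k : ℤ) : ℤ ×ₗ Fin w.length :=
  toLex (k, letterIndex hw s)

lemma IsIdentification.eq_occurrence (hf : IsIdentification w p f) (hw : IsOrdering b w) (z : ℤ) :
    f z = occurrence hw (p z) (ofLex (f z)).1 := by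
  rw [occurrence, ← hf.letter, letterIndex_get]
  rfl

lemma IsIdentification.letter_symm (hf : IsIdentification w p f) (hw : IsOrdering b w)
    (s : b.support) (k : ℤ) : p (f.symm (occurrence hw s k)) = s := by
  rw [← hf.letter, Equiv.apply_symm_apply]
  exact get_letterIndex hw s

variable {m : ℕ}

/-- The translation by `m` letters carries the occurrences of `s` to those of `η s`, and there it
shifts the number of the copy of `w` by a constant. -/
lemma IsIdentification.exists_shift (hf : IsIdentification w p f) (hw : IsOrdering b w)
    (hper : ∀ z, p (z + m) = opposition b (p z)) :
    ∃ τ : b.support → ℤ, ∀ z k, f z = occurrence hw (p z) k →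
      f (z + m) = occurrence hw (opposition b (p z)) (k + τ (p z)) := by
  refine ⟨fun s => (ofLex (f (f.symm (occurrence hw s 0) + m))).1, fun z k hz => ?_⟩
  set s := p z with hs
  set φ : ℤ → ℤ := fun k => (ofLex (f (f.symm (occurrence hw s k) + m))).1 with hφdef
  have hφ : ∀ k, f (f.symm (occurrence hw s k) + m) = occurrence hw (opposition b s) (φ k) := by
    intro k
    have := hf.eq_occurrence hw (f.symm (occurrence hw s k) + m)
    rwa [hper, hf.letter_symm] at this
  have hmono : StrictMono φ := by
    intro k l hkl
    have h1 : f.symm (occurrence hw s k) < f.symm (occurrence hw s l) := by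
      rw [hf.lt_iff _ _ (Or.inl (by rw [hf.letter_symm, hf.letter_symm])),
        Equiv.apply_symm_apply, Equiv.apply_symm_apply]
      exact Prod.Lex.toLex_lt_toLex.2 (Or.inl hkl)
    have h2 := (hf.lt_iff _ _ (Or.inl (by
      rw [hper, hper, hf.letter_symm, hf.letter_symm]))).1 (Int.add_lt_add_right h1 m)
    rw [hφ, hφ] at h2
    rcases Prod.Lex.toLex_lt_toLex.1 h2 with h | ⟨-, h⟩
    · exact h
    · exact absurd h (lt_irrefl _)
  have hsurj : Function.Surjective φ := by
    intro l
    set z' := f.symm (occurrence hw (opposition b s) l) - m with hz'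
    have hpz : p z' = s := by
      refine opposition_injective b ?_
      rw [← hper, hz', sub_add_cancel, hf.letter_symm]
    refine ⟨(ofLex (f z')).1, ?_⟩
    have h1 := hf.eq_occurrence hw z'
    rw [hpz] at h1
    have h2 := hφ (ofLex (f z')).1
    rw [← h1, Equiv.symm_apply_apply, hz', sub_add_cancel, Equiv.apply_symm_apply] at h2
    exact (congrArg (fun x => (ofLex x).1) h2).symm
  have h1 := hφ k
  rw [← hz, Equiv.symm_apply_apply, eq_add_of_strictMono_of_surjective hmono hsurj] at h1
  exact h1

/-- The difference of the shifts of two non-commuting letters depends on `w` only. -/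
lemma IsIdentification.shift_sub_eq (hf : IsIdentification w p f) (hw : IsOrdering b w)
    (hper : ∀ z, p (z + m) = opposition b (p z)) {τ : b.support → ℤ}
    (hτ : ∀ z k, f z = occurrence hw (p z) k →
      f (z + m) = occurrence hw (opposition b (p z)) (k + τ (p z)))
    {s t : b.support} (hst : P.pairing s t ≠ 0) (hlt : letterIndex hw s < letterIndex hw t) :
    τ t - τ s =
      if letterIndex hw (opposition b s) < letterIndex hw (opposition b t) then 0 else 1 := by
  have hts : P.pairing t s ≠ 0 := fun h0 => hst (pairing_eq_zero_symm h0)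
  have hocc : ∀ u k, f (f.symm (occurrence hw u k) + m) =
      occurrence hw (opposition b u) (k + τ u) := by
    intro u k
    have := hτ (f.symm (occurrence hw u k)) k (by rw [hf.letter_symm, Equiv.apply_symm_apply])
    rwa [hf.letter_symm] at this
  have hmove : ∀ (u v : b.support) (k l : ℤ), P.pairing u v ≠ 0 →
      occurrence hw u k < occurrence hw v l →
      occurrence hw (opposition b u) (k + τ u) < occurrence hw (opposition b v) (l + τ v) := by
    intro u v k l huv h
    rw [← hocc, ← hocc, ← hf.lt_iff _ _ (Or.inr (by
      rwa [hper, hper, hf.letter_symm, hf.letter_symm, pairing_opposition]))]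
    refine Int.add_lt_add_right ?_ _
    rwa [hf.lt_iff _ _ (Or.inr (by rwa [hf.letter_symm, hf.letter_symm])),
      Equiv.apply_symm_apply, Equiv.apply_symm_apply]
  have h1 := hmove s t 0 0 hst (Prod.Lex.toLex_lt_toLex.2 (Or.inr ⟨rfl, hlt⟩))
  have h2 := hmove t s 0 1 hts (Prod.Lex.toLex_lt_toLex.2 (Or.inl zero_lt_one))
  have h3 := Prod.Lex.toLex_lt_toLex.1 h1
  have h4 := Prod.Lex.toLex_lt_toLex.1 h2
  split_ifs with hop
  · have := not_lt.2 hop.le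
    simp only [hop, this, and_true, and_false, or_false] at h3 h4
    omega
  · have hne : letterIndex hw (opposition b s) ≠ letterIndex hw (opposition b t) := by
      intro hh
      have := opposition_injective b (letterIndex_injective hw hh)
      rw [this] at hlt
      exact lt_irrefl _ hlt
    have hop' := lt_of_le_of_ne (not_lt.1 hop) hne.symm
    simp only [hop, hop', and_true, and_false, or_false] at h3 h4
    omega

end

/-- A set of letters that commute with all the other letters is stable under `η`. -/
lemma opposition_mem_of_orthogonal {K : Set b.support}
    (hK : ∀ t ∈ K, ∀ u ∉ K, P.pairing t u = 0) {s : b.support} (hs : s ∈ K) :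
    opposition b s ∈ K := by
  by_contra hη
  have key : ∀ l : List b.support, ∀ v : V, (∀ u ∉ K, coord b u v = 0) →
      ∀ u ∉ K, coord b u (wordProd b l • v) = 0 := by
    intro l
    induction l with
    | nil => intro v hv u hu; simpa using hv u hu
    | cons t l ih =>
      intro v hv u hu
      rw [wordProd_cons, mul_smul]
      have hv' := ih v hv
      set v' := wordProd b l • v
      by_cases htu : t = u
      · -- `t` lies outside of `K`, so it fixes every vector of the span of `K`.
        subst htu
        have hfix : P.coroot' t v' = 0 := by
          rw [← b.toWeightBasis.sum_repr v', map_sum]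
          refine Finset.sum_eq_zero fun x _ => ?_
          rw [map_smul, RootPairing.Base.toWeightBasis_apply,
            RootPairing.root_coroot'_eq_pairing]
          by_cases hx : x ∈ K
          · rw [hK x hx t hu, smul_zero]
          · have : coord b x v' = 0 := hv' x hx
            change coord b x v' • _ = _
            rw [this, zero_smul]
        rw [simpleReflection_smul, hfix, zero_smul, sub_zero, hv' t hu]
      · rw [coord_simpleReflection_smul_of_ne b htu, hv' u hu]
  obtain ⟨l, hl⟩ := exists_wordProd_eq b (longestElement b)
  have h1 := key l (P.root s) (fun u hu => coord_root_of_ne b fun hh => hu (hh ▸ hs)) _ hη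
  rw [hl, longestElement_smul_simple, map_neg, coord_root_self] at h1
  norm_num at h1

end

section

variable {ι V V' : Type*} [AddCommGroup V] [Module ℝ V] [AddCommGroup V'] [Module ℝ V']
  {P : RootPairing ι ℝ V V'} [Finite ι] [P.IsRootSystem] [P.IsCrystallographic] [P.IsReduced]
  {b : P.Base} {w : List b.support} {p p' : ℤ → b.support} {f f' : ℤ ≃ ℤ ×ₗ Fin w.length}
  {m m' : ℕ} {τ τ' : b.support → ℤ}

/-! ### Orbits determine the translations -/

/-- The translation by `m` letters carries the occurrence of a letter `s` in the `k`-th copy of `w`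
to the occurrence of `η s` in the copy with number `k + τ s`. -/
def IsShift (hw : IsOrdering b w) (p : ℤ → b.support) (f : ℤ ≃ ℤ ×ₗ Fin w.length) (m : ℕ)
    (τ : b.support → ℤ) : Prop :=
  ∀ z k, f z = occurrence hw (p z) k →
    f (z + m) = occurrence hw (opposition b (p z)) (k + τ (p z))

lemma IsShift.add_even {hw : IsOrdering b w} (hτ : IsShift hw p f m τ)
    (hf : IsIdentification w p f) (hper : ∀ z, p (z + m) = opposition b (p z)) (z k : ℤ)
    (hz : f z = occurrence hw (p z) k) (e : ℤ) :
    f (z + (e + e) * m) = occurrence hw (p z) (k + e * (τ (p z) + τ (opposition b (p z)))) := by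
  have hletter : ∀ e : ℤ, p (z + (e + e) * m) = p z := fun e => by
    rw [apply_add_mul_period hper, twist, if_pos ⟨e, rfl⟩]
  have hstep : ∀ (e l : ℤ), f (z + (e + e) * m) = occurrence hw (p z) l →
      f (z + ((e + 1) + (e + 1)) * m) =
        occurrence hw (p z) (l + τ (p z) + τ (opposition b (p z))) := by
    intro e l h
    have h1 := hτ (z + (e + e) * m) l (by rw [hletter]; exact h)
    rw [hletter] at h1
    have h2 := hτ (z + (e + e) * m + m) _ (by rw [hper, hletter]; exact h1)
    rw [hper, hletter, opposition_opposition] at h2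
    rw [← h2]
    congr 1
    ring
  induction e using Int.induction_on with
  | zero => simpa using hz
  | succ e ih =>
    rw [hstep _ _ ih]
    congr 1
    ring
  | pred e ih =>
    have h1 := hf.eq_occurrence hw (z + ((-e - 1) + (-e - 1)) * m)
    rw [hletter] at h1
    have h2 := hstep _ _ h1
    rw [sub_add_cancel, ih] at h2
    have h3 := congrArg (fun x => (ofLex x).1) h2
    simp only [occurrence, ofLex_toLex] at h3
    rw [h1]
    congr 1
    linarith

lemma IsShift.add_opposition_pos {hw : IsOrdering b w} (hτ : IsShift hw p f m τ)
    (hf : IsIdentification w p f) (hper : ∀ z, p (z + m) = opposition b (p z)) (hm : 0 < m)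
    (z : ℤ) : 0 < τ (p z) + τ (opposition b (p z)) := by
  have hz := hf.eq_occurrence hw z
  have h1 := hτ.add_even hf hper z _ hz 1
  have hp : p z = p (z + (1 + 1) * m) := by
    rw [apply_add_mul_period hper, twist, if_pos ⟨1, rfl⟩]
  have h2 := (hf.lt_iff z (z + (1 + 1) * m) (Or.inl hp)).1 (by omega)
  rw [h1, hz] at h2
  rcases Prod.Lex.toLex_lt_toLex.1 h2 with h | ⟨-, h⟩
  · simp only [occurrence, ofLex_toLex] at h
    omega
  · exact absurd h (lt_irrefl _)

/-- The two translations differ by a constant on the letters of each component of the Coxeter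
graph. -/
lemma IsShift.sub_eq_of_pairing_ne_zero {hw : IsOrdering b w} (hτ : IsShift hw p f m τ)
    (hτ' : IsShift hw p' f' m' τ') (hf : IsIdentification w p f) (hf' : IsIdentification w p' f')
    (hper : ∀ z, p (z + m) = opposition b (p z)) (hper' : ∀ z, p' (z + m') = opposition b (p' z))
    {s t : b.support} (hst : P.pairing s t ≠ 0) : τ s - τ' s = τ t - τ' t := by
  rcases lt_trichotomy (letterIndex hw s) (letterIndex hw t) with h | h | h
  · have h1 := hf.shift_sub_eq hw hper hτ hst h
    have h2 := hf'.shift_sub_eq hw hper' hτ' hst h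
    omega
  · rw [letterIndex_injective hw h]
  · have hts : P.pairing t s ≠ 0 := fun h0 => hst (pairing_eq_zero_symm h0)
    have h1 := hf.shift_sub_eq hw hper hτ hts h
    have h2 := hf'.shift_sub_eq hw hper' hτ' hts h
    omega

lemma IsShift.sub_opposition_eq {hw : IsOrdering b w} (hτ : IsShift hw p f m τ)
    (hτ' : IsShift hw p' f' m' τ') (hf : IsIdentification w p f) (hf' : IsIdentification w p' f')
    (hper : ∀ z, p (z + m) = opposition b (p z)) (hper' : ∀ z, p' (z + m') = opposition b (p' z))
    (s : b.support) : τ (opposition b s) - τ' (opposition b s) = τ s - τ' s := by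
  refine opposition_mem_of_orthogonal (K := {t | τ t - τ' t = τ s - τ' s}) ?_ rfl
  intro t ht u hu
  by_contra hne
  exact hu ((hτ.sub_eq_of_pairing_ne_zero hτ' hf hf' hper hper' hne).symm.trans ht)

/-- If the first translation moves a position to another position of its orbit under the second
one, then twice the difference of the translations is a multiple of the square of the second. -/
lemma IsShift.exists_two_mul_sub_eq {hw : IsOrdering b w} (hτ : IsShift hw p f m τ)
    (hτ' : IsShift hw p' f' m' τ') (hf : IsIdentification w p f) (hf' : IsIdentification w p' f')
    (hper' : ∀ z, p' (z + m') = opposition b (p' z)) {z z' : ℤ} (hz : f z = f' z') {l : ℤ}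
    (hl : f (z + m) = f' (z' + l * m')) :
    ∃ D : ℤ, 2 * (τ (p z) - τ' (p z)) = D * (τ' (p z) + τ' (opposition b (p z))) := by
  have hpz : p' z' = p z := by rw [← hf.letter, ← hf'.letter, hz]
  set s := p z with hs
  obtain ⟨k, hk⟩ : ∃ k, f z = occurrence hw s k := ⟨_, hf.eq_occurrence hw z⟩
  have hk' : f' z' = occurrence hw (p' z') k := by rw [← hz, hk, hpz]
  have h1 := hτ z k hk
  rw [← hs, hl] at h1
  set y := z' + (l - 1) * m' with hy
  have hyl : z' + l * m' = y + m' := by rw [hy]; ring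
  rw [hyl] at h1
  have hpy : p' y = s := by
    refine opposition_injective b ?_
    rw [← hper', ← hf'.letter, h1]
    exact get_letterIndex hw _
  have h2 := hf'.eq_occurrence hw y
  have h3 := hτ' y _ h2
  rw [hpy] at h2 h3
  rw [h1] at h3
  have h4 := congrArg (fun x => (ofLex x).1) h3
  simp only [occurrence, ofLex_toLex] at h4
  refine ⟨l - 1, ?_⟩
  rcases Int.even_or_odd (l - 1) with ⟨e, he⟩ | ⟨e, he⟩
  · have h5 := hτ'.add_even hf' hper' z' k hk' e
    rw [← he, ← hy, hpz] at h5
    have h6 := congrArg (fun x => (ofLex x).1) h5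
    simp only [occurrence, ofLex_toLex] at h6
    rw [he]
    linarith
  · have h5 := hτ'.add_even hf' hper' z' k hk' e
    have hpe : p' (z' + (e + e) * m') = s := by
      rw [apply_add_mul_period hper', twist, if_pos ⟨e, rfl⟩, hpz]
    have h6 := hτ' (z' + (e + e) * m') _ (by rw [hpe, h5, hpz])
    have hye : z' + (e + e) * m' + m' = y := by rw [hy, he]; ring
    have hη : opposition b s = s := by
      have h7 := hper' (z' + (e + e) * m')
      rwa [hye, hpy, hpe, eq_comm] at h7
    rw [hye, hpe] at h6
    have h7 := congrArg (fun x => (ofLex x).1) h6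
    simp only [occurrence, ofLex_toLex] at h7
    rw [he]
    rw [hη] at h7 ⊢
    linarith

/-- If an orbit of one translation is an orbit of the other one, then the two translations agree on
the letters of that orbit. -/
lemma IsShift.eq_of_range_eq {hw : IsOrdering b w} (hτ : IsShift hw p f m τ)
    (hτ' : IsShift hw p' f' m' τ') (hf : IsIdentification w p f) (hf' : IsIdentification w p' f')
    (hper : ∀ z, p (z + m) = opposition b (p z)) (hper' : ∀ z, p' (z + m') = opposition b (p' z))
    (hm : 0 < m) (hm' : 0 < m') {i i' : ℤ}
    (h : Set.range (fun k : ℤ => f (i + k * m)) = Set.range fun k : ℤ => f' (i' + k * m')) :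
    τ (p i) = τ' (p i) ∧ τ (opposition b (p i)) = τ' (opposition b (p i)) := by
  obtain ⟨k₀, hk₀⟩ : f i ∈ Set.range fun k : ℤ => f' (i' + k * m') := by
    rw [← h]
    exact ⟨0, by simp⟩
  obtain ⟨l, hl⟩ : f (i + m) ∈ Set.range fun k : ℤ => f' (i' + k * m') := by
    rw [← h]
    exact ⟨1, by simp⟩
  obtain ⟨l', hl'⟩ : f' (i' + k₀ * m' + m') ∈ Set.range fun k : ℤ => f (i + k * m) := by
    rw [h]
    exact ⟨k₀ + 1, by simp only; congr 1; ring⟩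
  simp only at hk₀ hl hl'
  set z' := i' + k₀ * m' with hz'
  have hpz : p' z' = p i := by rw [← hf.letter, ← hf'.letter, hk₀]
  obtain ⟨D, hD⟩ := hτ.exists_two_mul_sub_eq hτ' hf hf' hper' hk₀.symm (l := l - k₀) (by
    rw [← hl]
    congr 1
    rw [hz']
    ring)
  obtain ⟨D', hD'⟩ := hτ'.exists_two_mul_sub_eq hτ hf' hf hper hk₀ hl'.symm
  rw [hpz] at hD'
  have hη := hτ.sub_opposition_eq hτ' hf hf' hper hper' (p i)
  have hpos := hτ.add_opposition_pos hf hper hm i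
  have hpos' := hτ'.add_opposition_pos hf' hper' hm' z'
  rw [hpz] at hpos'
  set A := τ (p i) + τ (opposition b (p i)) with hA
  set A' := τ' (p i) + τ' (opposition b (p i)) with hA'
  -- The squares of the translations divide each other, hence are equal.
  have h1 : A = (1 + D) * A' := by linarith
  have h2 : A' = (1 + D') * A := by linarith
  have h3 : (1 + D) * (1 + D') = 1 := by
    have : ((1 + D) * (1 + D')) * A = 1 * A := by
      rw [mul_assoc, ← h2, ← h1, one_mul]
    exact mul_right_cancel₀ hpos.ne' this
  have h4 : 0 < 1 + D := pos_of_mul_pos_left (h1 ▸ hpos) hpos'.le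
  rcases Int.eq_one_or_neg_one_of_mul_eq_one h3 with h5 | h5
  · have h6 : D = 0 := by omega
    rw [h6, zero_mul] at hD
    omega
  · omega

/-- Where the translations agree, the bijection between the two sequences intertwines them. -/
lemma IsShift.symm_apply_add {hw : IsOrdering b w} (hτ : IsShift hw p f m τ)
    (hτ' : IsShift hw p' f' m' τ') (hf : IsIdentification w p f) (hf' : IsIdentification w p' f')
    (hper : ∀ z, p (z + m) = opposition b (p z)) {z : ℤ} (h : τ (p z) = τ' (p z))
    (hη : τ (opposition b (p z)) = τ' (opposition b (p z))) (r : ℤ) :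
    f'.symm (f (z + r * m)) = f'.symm (f z) + r * m' := by
  have hstep : ∀ r : ℤ, f'.symm (f (z + (r + 1) * m)) = f'.symm (f (z + r * m)) + m' := by
    intro r
    have hr : τ (p (z + r * m)) = τ' (p (z + r * m)) := by
      rw [apply_add_mul_period hper, twist]
      split_ifs
      exacts [h, hη]
    have h0 := hf.eq_occurrence hw (z + r * m)
    have hp' : p' (f'.symm (f (z + r * m))) = p (z + r * m) := by
      rw [← hf'.letter, Equiv.apply_symm_apply, hf.letter]
    have h1 := hτ _ _ h0
    have h2 := hτ' (f'.symm (f (z + r * m))) _ (by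
      rw [hp', Equiv.apply_symm_apply]
      exact h0)
    rw [Equiv.symm_apply_eq, h2, hp', ← hr, ← h1]
    congr 1
    ring
  induction r using Int.induction_on with
  | zero => simp
  | succ r ih => rw [hstep, ih]; ring
  | pred r ih =>
    have := hstep (-r - 1)
    rw [sub_add_cancel, ih] at this
    linarith

lemma exists_cyclicIndex_eq_add {n : ℕ} (i j : Fin n) :
    ∃ u : ℤ, (i : ℤ) + cyclicIndex i j = j + u * n := by
  rw [cyclicIndex]
  split_ifs with h
  · have : (i : ℕ) ≤ j := h
    exact ⟨0, by omega⟩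
  · exact ⟨1, by omega⟩

/-- The coefficients of two periodic words agree at positions with the same orbits. -/
theorem meshFun_eq_of_range_eq (hw : IsOrdering b w) (hm : 0 < m) (hm' : 0 < m')
    (hf : IsIdentification w p f) (hf' : IsIdentification w p' f')
    (hper : ∀ z, p (z + m) = opposition b (p z)) (hper' : ∀ z, p' (z + m') = opposition b (p' z))
    (h : IsReducedSubword b (fun l : ℕ => p l) m (laterPositions fun l : ℕ => p l)
      (longestElement b))
    (h' : IsReducedSubword b (fun l : ℕ => p' l) m' (laterPositions fun l : ℕ => p' l)
      (longestElement b))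
    (i j : Fin m) (i' j' : Fin m')
    (hi : Set.range (fun k : ℤ => f (i + k * m)) = Set.range fun k : ℤ => f' (i' + k * m'))
    (hj : Set.range (fun k : ℤ => f (j + k * m)) = Set.range fun k : ℤ => f' (j' + k * m')) :
    meshFun b (fun z => p (i + z)) m (cyclicIndex i j) =
      meshFun b (fun z => p' (i' + z)) m' (cyclicIndex i' j') := by
  obtain ⟨τ, hτ⟩ := hf.exists_shift hw hper
  obtain ⟨τ', hτ'⟩ := hf'.exists_shift hw hper'
  replace hτ : IsShift hw p f m τ := hτ
  replace hτ' : IsShift hw p' f' m' τ' := hτ'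
  obtain ⟨hτi, hτi'⟩ := hτ.eq_of_range_eq hτ' hf hf' hper hper' hm hm' hi
  obtain ⟨hτj, hτj'⟩ := hτ.eq_of_range_eq hτ' hf hf' hper hper' hm hm' hj
  have hEi := hτ.symm_apply_add hτ' hf hf' hper hτi hτi'
  have hEj := hτ.symm_apply_add hτ' hf hf' hper hτj hτj'
  obtain ⟨k₀, hk₀⟩ : f i ∈ Set.range fun k : ℤ => f' (i' + k * m') := by
    rw [← hi]
    exact ⟨0, by simp⟩
  obtain ⟨k₁, hk₁⟩ : f j ∈ Set.range fun k : ℤ => f' (j' + k * m') := by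
    rw [← hj]
    exact ⟨0, by simp⟩
  simp only at hk₀ hk₁
  set F : ℤ ≃ ℤ := f.trans f'.symm with hF
  have hFi : F i = i' + k₀ * m' := by rw [hF, Equiv.trans_apply, ← hk₀, Equiv.symm_apply_apply]
  have hFj : F j = j' + k₁ * m' := by rw [hF, Equiv.trans_apply, ← hk₁, Equiv.symm_apply_apply]
  replace hEi : ∀ r : ℤ, F (i + r * m) = F i + r * m' := hEi
  replace hEj : ∀ r : ℤ, F (j + r * m) = F j + r * m' := hEj
  have hFp : ∀ z, p' (F z) = p z := fun z => by
    rw [← hf'.letter, hF, Equiv.trans_apply, Equiv.apply_symm_apply, hf.letter]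
  have hFlt : ∀ y z, (p y = p z ∨ P.pairing (p y) (p z) ≠ 0) → (y < z ↔ F y < F z) := by
    intro y z hyz
    rw [hf.lt_iff y z hyz, hf'.lt_iff (F y) (F z) (by rwa [hFp, hFp]), hF, Equiv.trans_apply,
      Equiv.trans_apply, Equiv.apply_symm_apply, Equiv.apply_symm_apply]
  -- The bijection of positions relative to the first letters of the two windows.
  let E : ℤ ≃ ℤ := ((Equiv.addLeft (i : ℤ)).trans F).trans (Equiv.subRight (i' + k₀ * m' : ℤ))
  have hE : ∀ z, E z = F (i + z) - (i' + k₀ * m') := fun z => rfl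
  have hEp : ∀ z, p' (i' + E z) = twist b (-k₀) (p (i + z)) := by
    intro z
    rw [hE, ← hFp, ← apply_add_mul_period hper']
    congr 1
    ring
  obtain ⟨u, hu⟩ := exists_cyclicIndex_eq_add i j
  obtain ⟨u', hu'⟩ := exists_cyclicIndex_eq_add i' j'
  refine meshFun_eq_of_equiv (r := k₁ + u - k₀ - u') hm hm'
    ((hf.interlaced hw).shift i) ((hf'.interlaced hw).shift i')
    (fun z => by rw [← add_assoc]; exact hper _) (fun z => by rw [← add_assoc]; exact hper' _)
    (isReducedSubword_laterPositions_shift (hf.interlaced hw) hper h i)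
    (isReducedSubword_laterPositions_shift (hf'.interlaced hw) hper' h' i')
    E ?_ ?_ ?_ ?_ ?_ (cyclicIndex_lt i j) (cyclicIndex_lt i' j') ?_ ?_
  · rw [hE, add_zero, hFi, sub_self]
  · have := hEi 1
    rw [one_mul, one_mul] at this
    rw [hE, this, hFi, add_sub_cancel_left]
  · intro y z
    rw [hEp, hEp, (twist_injective _).eq_iff]
  · intro y z
    rw [hEp, hEp, pairing_twist]
  · intro y z hyz
    have := hFlt (i + y) (i + z) hyz
    rw [hE, hE]
    omega
  · rw [hE, hu, hEj, hFj]
    linear_combination -hu'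
  · have h1 : (i : ℤ) + (cyclicIndex i j - (k₁ + u - k₀ - u') * m) =
        j + (k₀ + u' - k₁) * m := by linear_combination hu
    rw [hE, h1, hEj, hFj]
    linear_combination -hu'

/-- The coefficient `{i ‖ j}` exists, is unique, and depends only on the orbits of `i` and `j` in
`⋯ w w w ⋯`. -/
theorem exists_forall_isCompatibilityDegree_iff (hw : IsOrdering b w) {c c' : List b.support}
    (hc : IsCoxeterWord b c) (hc' : IsCoxeterWord b c')
    (e : CommutationEquiv (tildeWordQ b c) (tildeWord b w))
    (e' : CommutationEquiv (tildeWordQ b c') (tildeWord b w))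
    (i j : Fin (wordQ b c).length) (i' j' : Fin (wordQ b c').length)
    (hi : orbit b e i = orbit b e' i') (hj : orbit b e j = orbit b e' j') :
    ∃ d : ℝ, (∀ x, IsCompatibilityDegree b (wordQ b c) i j x ↔ x = d) ∧
      (∀ x, IsCompatibilityDegree b (wordQ b c') i' j' x ↔ x = d) := by
  have hm : 0 < (wordQ b c).length := i.pos
  have hm' : 0 < (wordQ b c').length := i'.pos
  have hf := isIdentification_of_commutationEquiv hm e
  have hf' := isIdentification_of_commutationEquiv hm' e'
  have h := isReducedSubword_wordQ hc.isOrdering hm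
  have h' := isReducedSubword_wordQ hc'.isOrdering hm'
  rw [orbit_eq_range hm, orbit_eq_range hm'] at hi hj
  refine ⟨_, fun x => isCompatibilityDegree_iff hm (hf.interlaced hw) h i j x, fun x => ?_⟩
  rw [isCompatibilityDegree_iff hm' (hf'.interlaced hw) h' i' j' x,
    meshFun_eq_of_range_eq hw hm hm' hf hf' (periodicWord_add_length hm)
      (periodicWord_add_length hm') h h' i j i' j' hi hj]

end

end ClusterOrbit

end

theorem proposition4p2 {ι V V' : Type*} [Finite ι] [AddCommGroup V] [Module ℝ V]
    [AddCommGroup V'] [Module ℝ V'] (P : RootPairing ι ℝ V V') [P.IsRootSystem]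
    [P.IsCrystallographic] [P.IsReduced] (b : P.Base)
    (w : List b.support) (hw : ClusterOrbit.IsOrdering b w) :
    (∀ (c c' : List b.support), ClusterOrbit.IsCoxeterWord b c → ClusterOrbit.IsCoxeterWord b c' →
      ∀ (e : ClusterOrbit.CommutationEquiv
            (ClusterOrbit.tildeWordQ b c) (ClusterOrbit.tildeWord b w))
        (e' : ClusterOrbit.CommutationEquiv
            (ClusterOrbit.tildeWordQ b c') (ClusterOrbit.tildeWord b w))
        (i j : Fin (ClusterOrbit.wordQ b c).length)
        (i' j' : Fin (ClusterOrbit.wordQ b c').length),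
        ClusterOrbit.orbit b e i = ClusterOrbit.orbit b e' i' →
        ClusterOrbit.orbit b e j = ClusterOrbit.orbit b e' j' →
        ∃ d : ℝ,
          (∀ x, ClusterOrbit.IsCompatibilityDegree b (ClusterOrbit.wordQ b c) i j x ↔ x = d) ∧
          (∀ x, ClusterOrbit.IsCompatibilityDegree b (ClusterOrbit.wordQ b c') i' j' x ↔ x = d)) ∧
    (∃ F : Set (ℤ ×ₗ Fin w.length) → Set (ℤ ×ₗ Fin w.length) → ℝ,
      ∀ c : List b.support, ClusterOrbit.IsCoxeterWord b c →
      ∀ (e : ClusterOrbit.CommutationEquiv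
            (ClusterOrbit.tildeWordQ b c) (ClusterOrbit.tildeWord b w))
        (i j : Fin (ClusterOrbit.wordQ b c).length) (x : ℝ),
        ClusterOrbit.IsCompatibilityDegree b (ClusterOrbit.wordQ b c) i j x ↔
          x = F (ClusterOrbit.orbit b e i) (ClusterOrbit.orbit b e j)) := by
  classical
  have main : ∀ (c c' : List b.support), ClusterOrbit.IsCoxeterWord b c →
      ClusterOrbit.IsCoxeterWord b c' →
      ∀ (e : ClusterOrbit.CommutationEquiv
            (ClusterOrbit.tildeWordQ b c) (ClusterOrbit.tildeWord b w))
        (e' : ClusterOrbit.CommutationEquiv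
            (ClusterOrbit.tildeWordQ b c') (ClusterOrbit.tildeWord b w))
        (i j : Fin (ClusterOrbit.wordQ b c).length)
        (i' j' : Fin (ClusterOrbit.wordQ b c').length),
        ClusterOrbit.orbit b e i = ClusterOrbit.orbit b e' i' →
        ClusterOrbit.orbit b e j = ClusterOrbit.orbit b e' j' →
        ∃ d : ℝ,
          (∀ x, ClusterOrbit.IsCompatibilityDegree b (ClusterOrbit.wordQ b c) i j x ↔ x = d) ∧
          (∀ x, ClusterOrbit.IsCompatibilityDegree b (ClusterOrbit.wordQ b c') i' j' x ↔ x = d) :=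
    fun c c' hc hc' e e' i j i' j' hi hj =>
      ClusterOrbit.exists_forall_isCompatibilityDegree_iff hw hc hc' e e' i j i' j' hi hj
  refine ⟨main, ?_⟩
  -- The value at a pair of orbits is the coefficient of any pair of positions with these orbits.
  let R : Set (ℤ ×ₗ Fin w.length) → Set (ℤ ×ₗ Fin w.length) → ℝ → Prop := fun o₁ o₂ d =>
    ∃ (c : List b.support) (_ : ClusterOrbit.IsCoxeterWord b c)
      (e : ClusterOrbit.CommutationEquiv
        (ClusterOrbit.tildeWordQ b c) (ClusterOrbit.tildeWord b w))
      (i j : Fin (ClusterOrbit.wordQ b c).length), ClusterOrbit.orbit b e i = o₁ ∧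
        ClusterOrbit.orbit b e j = o₂ ∧
        ClusterOrbit.IsCompatibilityDegree b (ClusterOrbit.wordQ b c) i j d
  refine ⟨fun o₁ o₂ => if h : ∃ d, R o₁ o₂ d then h.choose else 0, fun c hc e i j x => ?_⟩
  have hex : ∃ d, R (ClusterOrbit.orbit b e i) (ClusterOrbit.orbit b e j) d := by
    obtain ⟨d, hd, -⟩ := main c c hc hc e e i j i j rfl rfl
    exact ⟨d, c, hc, e, i, j, rfl, rfl, (hd d).2 rfl⟩
  change ClusterOrbit.IsCompatibilityDegree b (ClusterOrbit.wordQ b c) i j x ↔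
    x = if h : ∃ d, R (ClusterOrbit.orbit b e i) (ClusterOrbit.orbit b e j) d then h.choose else 0
  rw [dif_pos hex]
  obtain ⟨c', hc', e', i', j', hi, hj, hd'⟩ := hex.choose_spec
  obtain ⟨d, hd, hd''⟩ := main c c' hc hc' e e' i j i' j' hi.symm hj.symm
  rw [hd x, (hd'' _).1 hd']
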